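/- **Setting.** Let $K\ge 2$, let $\boldsymbol\varrho=(\rho_0,\rho_1,\rho_2)$ with $\rho_0,\rho_1,\rho_2\ge 0$, and let $M\ge 0$. For a file size $F$, let $W_0,W_1,W_2$ be independent descriptions, $W_s$ uniform on the bit strings of length $\lfloor F\rho_s\rfloor$. File $i\in\{1,2\}$ consists of the common description $W_0$ and the private description $W_i$. A *multiple-request (MR) scheme* for $K$ receivers consists of cache encoders, which store in the cache of each receiver $k$ a function $Z_k$ of $(W_0,W_1,W_2)$ with values in the bit strings of length $\lfloor FM\rfloor$; a multicast encoder, which for each demand $\mathbf d\in\{1,2\}^K$ maps $(\mathbf d,Z_1,\dots,Z_K,W_0,W_1,W_2)$ to a finite binary word $Y_{\mathbf d}$; and decoders, by which receiver $k$ estimates $(W_0,W_{d_k})$ from $(\mathbf d,Y_{\mathbf d},Z_k)$. Its error probability is the maximum over $\mathbf d$ of the probability that at least one receiver does not recover both of its descriptions. Its average rate is $\mathbb E[\mathrm{length}(Y_{\mathbf d})]/F$, with $\mathbf d$ uniform on $\{1,2\}^K$ and independent of the descriptions. A pair $(R,M)$ is achievable if some sequence of MR schemes (one for each $F$) for cache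 capacity $M$ has error probability tending to $0$ and average rate with limit superior at most $R$. The *MR average rate-memory function* is $\bar R^*(M,\boldsymbol\varrho)=\inf\{R:(R,M)\in\mathcal R\}$, where $\mathcal R$ is the closure of the set of achievable pairs. **Proposed scheme.** Put $\gamma=\frac1K\min\{\rho_1,\rho_2\}$. The common description gets memory $m_0=0$ if $M<2\gamma$, $m_0=M-2\gamma$ if $2\gamma\le M<2\gamma+\rho_0$, and $m_0=\rho_0$ otherwise; the private descriptions get $m_1=\min\{M-m_0,\rho_1+\rho_2\}$. All receivers cache the first $\lfloor Fm_0\rfloor$ bits of $W_0$; the rest of $W_0$ is sent uncoded. The private descriptions use memory sharing (on the two neighbouring points) between the following placements: * $m_1=0$: nothing is cached. * $m_1=2\gamma$: a part of rate $\min\{\rho_1,\rho_2\}$ of each of $W_1,W_2$ is cut into $K$ equal packets, the $k$-th of which is cached by receiver $k$ only; the rest of the longer description is not cached. * $m_1=\rho_1+\rho_2-2\gamma$: the same packets, the $k$-th of which is cached by all receivers except $k$; the rest of the longer description is cached by all receivers. * $m_1=\rho_1+\rho_2$: everything is cached by all receivers. All packet sizes are rounded down to whole bits. On delivery, the bits of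 the requested private descriptions that nobody caches are sent uncoded. For packets cached by one receiver, choose for each requested file the first receiver requesting it as its leader; for each pair $\{k,l\}$ of receivers that contains a leader, send the bitwise sum of packet $l$ of $W_{d_k}$ and packet $k$ of $W_{d_l}$. For packets cached by all receivers but one, send the bitwise sum over $k$ of packet $k$ of $W_{d_k}$. Each receiver outputs the descriptions of its requested file in some library that is consistent with its cache and the received codeword. **Theorem.** The error probability of the proposed scheme tends to $0$ and its average rate converges, as $F\to\infty$, to a limit $\bar R_{MR}(M,\boldsymbol\varrho)$, such that: 1. If $M\in\big[\rho_0+\rho_1+\rho_2-\tfrac2K\min\{\rho_1,\rho_2\},\ \rho_0+\rho_1+\rho_2\big]$, then $\bar R_{MR}(M,\boldsymbol\varrho)=\bar R^*(M,\boldsymbol\varrho)$. 2. For all other $M\ge 0$, $\;0\le \bar R_{MR}(M,\boldsymbol\varrho)-\bar R^*(M,\boldsymbol\varrho)\le\big(\tfrac14-2^{-K}\big)(\rho_1+\rho_2)$. 3. If $K=2$, then $\bar R_{MR}(M,\boldsymbol\varrho)=\bar R^*(M,\boldsymbol\varrho)$ for all $M\ge 0$. -/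

import Mathlib

open Filter Topology

namespace CodedCaching

/-! ### Multiple-request caching schemes for two files and `K` receivers

Description `0` is the common description, descriptions `1` and `2` are the private ones. The
files are indexed by `Fin 2`; file `i` consists of descriptions `0` and `i.succ`. -/

/-- The three descriptions; description `s` has `n s` bits. -/
abbrev Library (n : Fin 3 → ℕ) : Type := (s : Fin 3) → Fin (n s) → Bool

/-- A demand: receiver `k` requests file `d k`. -/
abbrev Demand (K : ℕ) : Type := Fin K → Fin 2

/-- A cache of `c` bits. -/
abbrev Cache (c : ℕ) : Type := Fin c → Bool

/-- A multiple-request scheme for `K` receivers with `c`-bit caches and descriptions of `n s` bits: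
cache encoders, a multicast encoder with variable-length binary codewords, and multicast decoders,
which output the two descriptions of the requested file. -/
structure MRScheme (K : ℕ) (n : Fin 3 → ℕ) (c : ℕ) where
  cache : Fin K → Library n → Cache c
  encode : Demand K → (Fin K → Cache c) → Library n → List Bool
  decode : (k : Fin K) → (d : Demand K) → List Bool → Cache c →
    (Fin (n 0) → Bool) × (Fin (n (d k).succ) → Bool)

namespace MRScheme

variable {K : ℕ} {n : Fin 3 → ℕ} {c : ℕ}

/-- The multicast codeword sent for demand `d` and library `w`. -/
def codeword (C : MRScheme K n c) (d : Demand K) (w : Library n) : List Bool :=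
  C.encode d (fun k => C.cache k w) w

/-- Some receiver fails to recover some description of the file it requests. -/
def Fails (C : MRScheme K n c) (d : Demand K) (w : Library n) : Prop :=
  ∃ k : Fin K, C.decode k d (C.codeword d w) (C.cache k w) ≠ (w 0, w (d k).succ)

/-- Worst-case (over the demands) probability of error, for independent descriptions that are
uniform bit strings, that is, for a uniformly distributed library. -/
noncomputable def errorProb (C : MRScheme K n c) : ℝ :=
  ⨆ d : Demand K, (Nat.card {w : Library n // C.Fails d w} : ℝ) / Nat.card (Library n)

/-- Expected codeword length in bits, for a uniform demand and a uniform library. -/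
noncomputable def expectedLength (C : MRScheme K n c) : ℝ :=
  (∑ d : Demand K, ∑ w : Library n, ((C.codeword d w).length : ℝ)) /
    ((Fintype.card (Demand K) : ℝ) * Fintype.card (Library n))

end MRScheme

/-- Description lengths `⌊F ρ s⌋` at file size `F` and rate tuple `ρ`. -/
noncomputable def descLength (ρ : Fin 3 → ℝ) (F : ℕ) : Fin 3 → ℕ := fun s => ⌊(F : ℝ) * ρ s⌋₊

/-- Cache length `⌊F M⌋` at file size `F` and cache capacity `M`. -/
noncomputable def cacheLength (M : ℝ) (F : ℕ) : ℕ := ⌊(F : ℝ) * M⌋₊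

/-- Multiple-request schemes at file size `F` for rate tuple `ρ` and cache capacity `M`. -/
abbrev MRSchemeAt (K : ℕ) (ρ : Fin 3 → ℝ) (M : ℝ) (F : ℕ) : Type :=
  MRScheme K (descLength ρ F) (cacheLength M F)

/-- Average multicast rate. -/
noncomputable def avgRate {K : ℕ} {ρ : Fin 3 → ℝ} {M : ℝ} {F : ℕ} (C : MRSchemeAt K ρ M F) : ℝ :=
  C.expectedLength / F

/-- Achievable average rate-memory pairs. The limit superior is taken in the extended reals. -/
def Achievable (K : ℕ) (ρ : Fin 3 → ℝ) (R M : ℝ) : Prop :=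
  0 ≤ M ∧ ∃ C : (F : ℕ) → MRSchemeAt K ρ M F,
    Tendsto (fun F => (C F).errorProb) atTop (𝓝 0) ∧
      limsup (fun F => ((avgRate (C F) : ℝ) : EReal)) atTop ≤ (R : EReal)

/-- The average rate-memory region, a set of pairs `(R, M)`. -/
def region (K : ℕ) (ρ : Fin 3 → ℝ) : Set (ℝ × ℝ) :=
  closure {p | Achievable K ρ p.1 p.2}

/-- The average rate-memory function. -/
noncomputable def optimalRate (K : ℕ) (ρ : Fin 3 → ℝ) (M : ℝ) : ℝ :=
  sInf {R | (R, M) ∈ region K ρ}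

/-! ### The proposed scheme

Placement is uncoded. Each private description is cut into
* `K` packets of `single` bits, the `k`-th one cached by receiver `k` only,
* `K` packets of `coSingle` bits, the `k`-th one cached by all receivers except `k`,
* a segment of `full i` bits, cached by all receivers,
* the remaining bits, cached by nobody.
All receivers cache the first `common` bits of the common description. -/

/-- The numbers of bits that determine the placement. -/
structure Split where
  common : ℕ
  single : ℕ
  coSingle : ℕ
  full : Fin 2 → ℕ

section Construction

variable {n : Fin 3 → ℕ}

/-- Bit number `j` of description `s`. -/
def bit (w : Library n) (s : Fin 3) (j : ℕ) : Bool :=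
  if h : j < n s then w s ⟨j, h⟩ else false

/-- The `len` bits of description `s` from position `start` on. -/
def bits (w : Library n) (s : Fin 3) (start len : ℕ) : List Bool :=
  (List.range len).map fun j => bit w s (start + j)

/-- Packet of private description `i` that only receiver `k` caches. -/
def singlePacket {K : ℕ} (p : Split) (w : Library n) (i : Fin 2) (k : Fin K) : List Bool :=
  bits w i.succ (k * p.single) p.single

/-- Packet of private description `i` that all receivers except `k` cache. -/
def coSinglePacket {K : ℕ} (p : Split) (w : Library n) (i : Fin 2) (k : Fin K) : List Bool :=
  bits w i.succ (K * p.single + k * p.coSingle) p.coSingle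

/-- Segment of private description `i` that all receivers cache. -/
def fullSegment (K : ℕ) (p : Split) (w : Library n) (i : Fin 2) : List Bool :=
  bits w i.succ (K * p.single + K * p.coSingle) (p.full i)

/-- The bits of private description `i` that nobody caches. -/
def uncachedSegment (K : ℕ) (p : Split) (w : Library n) (i : Fin 2) : List Bool :=
  bits w i.succ (K * p.single + K * p.coSingle + p.full i)
    (n i.succ - (K * p.single + K * p.coSingle + p.full i))

/-- The content that receiver `k` caches. -/
def cacheList {K : ℕ} (p : Split) (k : Fin K) (w : Library n) : List Bool :=
  bits w 0 0 p.common ++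
    (List.finRange 2).flatMap fun i =>
      singlePacket p w i k ++
        (((List.finRange K).filter fun j => j ≠ k).flatMap fun j => coSinglePacket p w i j) ++
        fullSegment K p w i

/-- Bitwise sum. -/
def xorBits (x y : List Bool) : List Bool := List.zipWith xor x y

/-- The leader of a requested file is the first receiver that requests it. -/
def IsLeader {K : ℕ} (d : Demand K) (k : Fin K) : Prop := ∀ l : Fin K, l < k → d l ≠ d k

instance {K : ℕ} (d : Demand K) (k : Fin K) : Decidable (IsLeader d k) := by
  unfold IsLeader; infer_instance

/-- The pairs of receivers that contain at least one leader. -/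
def leaderPairs {K : ℕ} (d : Demand K) : List (Fin K × Fin K) :=
  ((List.finRange K).product (List.finRange K)).filter fun q =>
    q.1 < q.2 ∧ (IsLeader d q.1 ∨ IsLeader d q.2)

/-- The multicast codeword: the uncached part of the common description and the uncached segments
of the requested private descriptions are sent in plain; then, for each pair of receivers that
contains a leader, the sum of the two single packets that one of the two receivers wants and the
other one has; last, the sum over all receivers of the co-single packet that each one misses. -/
def codewordList {K : ℕ} (p : Split) (d : Demand K) (w : Library n) : List Bool :=
  bits w 0 p.common (n 0 - p.common) ++
    (((List.finRange 2).filter fun i => ∃ k, d k = i).flatMap fun i => uncachedSegment K p w i) ++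
    ((leaderPairs d).flatMap fun q =>
      xorBits (singlePacket p w (d q.1) q.2) (singlePacket p w (d q.2) q.1)) ++
    ((List.finRange K).map fun k => coSinglePacket p w (d k) k).foldl xorBits
      (List.replicate p.coSingle false)

open Classical in
/-- The scheme with placement `p`. The cached list is written into the `c` bits of the cache. A
receiver outputs the descriptions of a library that is consistent with its cache and with the
received codeword. -/
noncomputable def splitScheme (K : ℕ) (n : Fin 3 → ℕ) (c : ℕ) (p : Split) : MRScheme K n c where
  cache k w := fun j => (cacheList p k w).getD j false
  encode d _ w := codewordList p d w
  decode k d y z :=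
    if h : ∃ w : Library n, codewordList p d w = y ∧
        (fun j : Fin c => (cacheList p k w).getD j false) = z then
      (h.choose 0, h.choose (d k).succ)
    else (fun _ => false, fun _ => false)

end Construction

/-- Normalized placement of the private descriptions. -/
structure PrivateSplit where
  single : ℝ
  coSingle : ℝ
  full : Fin 2 → ℝ

/-- `γ = min {ρ₁, ρ₂} / K`. -/
noncomputable def gam (K : ℕ) (ρ : Fin 3 → ℝ) : ℝ := min (ρ 1) (ρ 2) / K

/-- Placement at private memory `0`: nothing is cached. -/
def corner0 : PrivateSplit := ⟨0, 0, fun _ => 0⟩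

/-- Placement at private memory `2γ`: `min {ρ₁, ρ₂}` of each private description is cut into `K`
packets, each one cached by one receiver; the rest of the longer one is not cached. -/
noncomputable def corner1 (K : ℕ) (ρ : Fin 3 → ℝ) : PrivateSplit := ⟨gam K ρ, 0, fun _ => 0⟩

/-- Placement at private memory `ρ₁ + ρ₂ - 2γ`: `min {ρ₁, ρ₂}` of each private description is cut
into `K` packets, each one cached by all receivers but one; the rest of the longer one is cached
by all receivers. -/
noncomputable def corner2 (K : ℕ) (ρ : Fin 3 → ℝ) : PrivateSplit :=
  ⟨0, gam K ρ, fun i => ρ i.succ - min (ρ 1) (ρ 2)⟩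

/-- Placement at private memory `ρ₁ + ρ₂`: everything is cached by all receivers. -/
def corner3 (ρ : Fin 3 → ℝ) : PrivateSplit := ⟨0, 0, fun i => ρ i.succ⟩

/-- Memory sharing: weight `1 - θ` for `A` and weight `θ` for `B`. -/
noncomputable def share (θ : ℝ) (A B : PrivateSplit) : PrivateSplit :=
  ⟨(1 - θ) * A.single + θ * B.single, (1 - θ) * A.coSingle + θ * B.coSingle,
    fun i => (1 - θ) * A.full i + θ * B.full i⟩

/-- Placement of the private descriptions at private memory `m ∈ [0, ρ₁ + ρ₂]`: memory sharing
between the two neighbouring corners. -/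
noncomputable def privateSplit (K : ℕ) (ρ : Fin 3 → ℝ) (m : ℝ) : PrivateSplit :=
  if m < 2 * gam K ρ then
    share (m / (2 * gam K ρ)) corner0 (corner1 K ρ)
  else if m < ρ 1 + ρ 2 - 2 * gam K ρ then
    share ((m - 2 * gam K ρ) / (ρ 1 + ρ 2 - 4 * gam K ρ)) (corner1 K ρ) (corner2 K ρ)
  else
    share ((m - (ρ 1 + ρ 2 - 2 * gam K ρ)) / (2 * gam K ρ)) (corner2 K ρ) (corner3 ρ)

/-- Memory given to the common description: none up to the threshold `2γ`, at which the slope of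
the private delivery rate drops below `1` in absolute value; then all additional memory until the
common description is fully cached. -/
noncomputable def commonMemory (K : ℕ) (ρ : Fin 3 → ℝ) (M : ℝ) : ℝ :=
  if M < 2 * gam K ρ then 0
  else if M < 2 * gam K ρ + ρ 0 then M - 2 * gam K ρ
  else ρ 0

/-- Memory given to the private descriptions: all that is left, up to `ρ₁ + ρ₂`. -/
noncomputable def privateMemory (K : ℕ) (ρ : Fin 3 → ℝ) (M : ℝ) : ℝ :=
  min (M - commonMemory K ρ M) (ρ 1 + ρ 2)

/-- The placement of the proposed scheme at file size `F`, in bits. -/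
noncomputable def proposedSplit (K : ℕ) (ρ : Fin 3 → ℝ) (M : ℝ) (F : ℕ) : Split where
  common := ⌊(F : ℝ) * commonMemory K ρ M⌋₊
  single := ⌊(F : ℝ) * (privateSplit K ρ (privateMemory K ρ M)).single⌋₊
  coSingle := ⌊(F : ℝ) * (privateSplit K ρ (privateMemory K ρ M)).coSingle⌋₊
  full := fun i => ⌊(F : ℝ) * (privateSplit K ρ (privateMemory K ρ M)).full i⌋₊

/-- The proposed multiple-request scheme. -/
noncomputable def proposedScheme (K : ℕ) (ρ : Fin 3 → ℝ) (M : ℝ) (F : ℕ) : MRSchemeAt K ρ M F :=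
  splitScheme K (descLength ρ F) (cacheLength M F) (proposedSplit K ρ M F)

end CodedCaching

namespace CodedCaching

/-! ### Logarithmic sums over a uniform sample space -/

/-! The scheme gives an upper bound on the rate and entropy inequalities give lower bounds; the
theorem compares two piecewise linear functions of `M`.

Converse. For codes without errors, write `L d` for the mean codeword length and `c` for the cache
length. A receiver that sees two codewords for different requests of its own learns the library, so
`n 0 + n 1 + n 2 ≤ L d + L d' + c`. If receivers `k` and `l` request different files in `d`, and `l`
requests `d k` in `d'`, then `(Y d, Z k)` and `(Y d', Z l)` both determine descriptions `0` and `(d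
k).succ` and jointly determine the library; submodularity counts the shared descriptions twice.
These bounds hold up to a sublinear loss for variable-length words. Adding two of them over the four
joint requests of two receivers and averaging over the others gives, with `S = ρ 1 + ρ 2`, the
bounds `4R ≥ 4 ρ 0 + 3S - 4M`, `4R ≥ 2 (ρ 0 + S - M)` and `4R ≥ 3 ρ 0 + 3S - min (ρ 1) (ρ 2) - 3M`
(`LengthBound`). Errors cost nothing in the limit: failing libraries are sent in full behind a flag
bit (`recovers_safeWord`, `LengthBound.le_of_achievable`).

Entropy enters only through sums of logarithms. If weights on the values of an injective map have
total at most `Ca`, concavity of the logarithm bounds their mean log by `log Ca - log |Ω|`;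
submodularity is this argument on the fibres of the shared part (`sum_log_add_sum_log_le`).

Achievability. Decoding is deterministic and exact (`eq_of_cacheList_eq_of_codewordList_eq`), and
counting leader pairs bounds the limiting rate (`limitRate_le`). Against the converse, the excess is
zero for large `M` and at most `(1/4 - 2^(-K)) S` otherwise. For `K = 2` this constant vanishes,
which gives optimality everywhere. -/

lemma sum_log_le_of_sum_le {Ω : Type*} [Fintype Ω] {f : Ω → ℝ} (hf : ∀ w, 0 < f w)
    {t : ℝ} (ht : 0 < t) (h : ∑ w, f w ≤ Fintype.card Ω * t) :
    ∑ w, Real.log (f w) ≤ Fintype.card Ω * Real.log t := by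
  -- Jensen's inequality in the form of the tangent line of the logarithm at `t`.
  have h1 : ∀ w, Real.log (f w) ≤ Real.log t + (f w / t - 1) := fun w => by
    have := Real.log_le_sub_one_of_pos (div_pos (hf w) ht)
    rw [Real.log_div (hf w).ne' ht.ne'] at this
    linarith
  calc ∑ w, Real.log (f w) ≤ ∑ w, (Real.log t + (f w / t - 1)) := Finset.sum_le_sum fun w _ => h1 w
    _ = Fintype.card Ω * Real.log t + ((∑ w, f w) / t - Fintype.card Ω) := by
        simp [Finset.sum_add_distrib, Finset.sum_div]
    _ ≤ _ := by
        have : (∑ w, f w) / t ≤ Fintype.card Ω := by rwa [div_le_iff₀ ht]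
        linarith

/-- Injectivity keeps the sum of `a (P w)` within the total weight, so Jensen applies with mean `Ca
/ |Ω|`. The total is bounded over finite sets because `A`, which will contain words, may be
infinite. -/
lemma sum_log_le_of_injective {Ω A : Type*} [Fintype Ω] [Nonempty Ω] {P : Ω → A}
    (hP : Function.Injective P) {a : A → ℝ} (ha : ∀ x, 0 < a x) {Ca : ℝ} (hCa : 0 < Ca)
    (hsum : ∀ S : Finset A, ∑ x ∈ S, a x ≤ Ca) :
    ∑ w, Real.log (a (P w)) ≤ Fintype.card Ω * (Real.log Ca - Real.log (Fintype.card Ω)) := by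
  have hΩ : (0 : ℝ) < Fintype.card Ω := by exact_mod_cast Fintype.card_pos
  rw [← Real.log_div hCa.ne' hΩ.ne']
  refine sum_log_le_of_sum_le (fun w => ha _) (by positivity) ?_
  rw [mul_div_cancel₀ _ hΩ.ne']
  simpa using hsum (Finset.univ.map ⟨P, hP⟩)

/-- If `P` determines `v`, the weights of the values of `P` on a fiber of `v` are on average at most
the share of the fiber in the total weight. -/
lemma sum_log_fiber_weight_le {Ω A V : Type*} [Fintype Ω] [Nonempty Ω] [Fintype V] [DecidableEq A]
    [DecidableEq V] {P : Ω → A} {v : Ω → V} (hPv : ∀ w w', P w = P w' → v w = v w')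
    {a : A → ℝ} (ha : ∀ x, 0 < a x) {Ca : ℝ} (hCa : 0 < Ca)
    (hs : ∀ S : Finset A, ∑ x ∈ S, a x ≤ Ca)
    {m : ℕ} (hfib : ∀ x : V, Nat.card {w // v w = x} ≤ m)
    (hm : Fintype.card V * m = Fintype.card Ω) :
    ∑ w, Real.log (∑ p ∈ (Finset.univ.filter fun w' => v w' = v w).image P, a p) ≤
      Fintype.card Ω * Real.log (Ca / Fintype.card V) := by
  have hVne : Nonempty V := ⟨v (Classical.arbitrary Ω)⟩
  have hV : (0 : ℝ) < Fintype.card V := by exact_mod_cast Fintype.card_pos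
  refine sum_log_le_of_sum_le (fun w => ?_) (by positivity) ?_
  · exact Finset.sum_pos (fun p _ => ha p) ⟨P w, Finset.mem_image_of_mem _ (by simp)⟩
  · set α : V → ℝ := fun x => ∑ p ∈ (Finset.univ.filter fun w' => v w' = x).image P, a p
    have hα0 : ∀ x, 0 ≤ α x := fun x => Finset.sum_nonneg fun p _ => (ha p).le
    -- Since `P` determines `v`, distinct fibres have disjoint images under `P`, and their weights
    -- add up inside one finite set.
    have hα : ∑ x, α x ≤ Ca := by
      rw [← Finset.sum_biUnion]
      · exact hs _
      · intro x _ y _ hxy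
        rw [Function.onFun, Finset.disjoint_left]
        intro p hp hp'
        simp only [Finset.mem_image, Finset.mem_filter, Finset.mem_univ, true_and] at hp hp'
        obtain ⟨w, hw, rfl⟩ := hp
        obtain ⟨w', hw', h⟩ := hp'
        exact hxy (by rw [← hw, ← hw']; exact (hPv _ _ h).symm)
    calc ∑ w, α (v w) = ∑ x, ∑ w with v w = x, α (v w) :=
          (Finset.sum_fiberwise _ _ _).symm
      _ = ∑ x, ((Finset.univ.filter fun w => v w = x).card : ℝ) * α x := by
          refine Finset.sum_congr rfl fun x _ => ?_
          rw [← nsmul_eq_mul, ← Finset.sum_const]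
          exact Finset.sum_congr rfl fun w hw => by rw [(Finset.mem_filter.1 hw).2]
      _ ≤ ∑ x, (m : ℝ) * α x := by
          refine Finset.sum_le_sum fun x _ => mul_le_mul_of_nonneg_right ?_ (hα0 x)
          have := hfib x
          rw [Nat.card_eq_fintype_card, Fintype.card_subtype] at this
          exact_mod_cast this
      _ ≤ m * Ca := by rw [← Finset.mul_sum]; gcongr
      _ = _ := by rw [← hm]; push_cast; field_simp

/-- Submodularity of entropy, in the form of an inequality between code lengths: `P` and `Q` both
determine `v`, and together they determine the sample point. -/
lemma sum_log_add_sum_log_le {Ω A B V : Type*} [Fintype Ω] [Nonempty Ω] [Fintype V]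
    {P : Ω → A} {Q : Ω → B} {v : Ω → V}
    (hPv : ∀ w w', P w = P w' → v w = v w') (hQv : ∀ w w', Q w = Q w' → v w = v w')
    (hPQ : ∀ w w', P w = P w' → Q w = Q w' → w = w')
    {a : A → ℝ} {b : B → ℝ} (ha : ∀ x, 0 < a x) (hb : ∀ x, 0 < b x) {Ca Cb : ℝ}
    (hCa : 0 < Ca) (hCb : 0 < Cb)
    (hasum : ∀ S : Finset A, ∑ x ∈ S, a x ≤ Ca) (hbsum : ∀ S : Finset B, ∑ x ∈ S, b x ≤ Cb)
    {m : ℕ} (hfib : ∀ x : V, Nat.card {w // v w = x} ≤ m)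
    (hm : Fintype.card V * m = Fintype.card Ω) :
    (∑ w, Real.log (a (P w))) + ∑ w, Real.log (b (Q w)) ≤
      Fintype.card Ω * (Real.log Ca + Real.log Cb - Real.log (Fintype.card V)
        - Real.log (Fintype.card Ω)) := by
  classical
  have hΩ : (0 : ℝ) < Fintype.card Ω := by exact_mod_cast Fintype.card_pos
  have hVne : Nonempty V := ⟨v (Classical.arbitrary Ω)⟩
  have hV : (0 : ℝ) < Fintype.card V := by exact_mod_cast Fintype.card_pos
  have hA := sum_log_fiber_weight_le hPv ha hCa hasum hfib hm
  have hB := sum_log_fiber_weight_le hQv hb hCb hbsum hfib hm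
  set α : V → ℝ := fun x => ∑ p ∈ (Finset.univ.filter fun w' => v w' = x).image P, a p with hαdef
  set β : V → ℝ := fun x => ∑ p ∈ (Finset.univ.filter fun w' => v w' = x).image Q, b p with hβdef
  have hαpos : ∀ w, 0 < α (v w) := fun w =>
    Finset.sum_pos (fun p _ => ha p) ⟨P w, Finset.mem_image_of_mem _ (by simp)⟩
  have hβpos : ∀ w, 0 < β (v w) := fun w =>
    Finset.sum_pos (fun p _ => hb p) ⟨Q w, Finset.mem_image_of_mem _ (by simp)⟩
  -- Conditional subadditivity of entropy: on a fibre of `v` the map `w ↦ (P w, Q w)` is injective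
  -- into the product of the two images, so the normalized product weights sum to at most `1` there
  -- and to at most `|V|` overall.
  have hC : ∑ w, Real.log (a (P w) * b (Q w) / (α (v w) * β (v w))) ≤
      Fintype.card Ω * Real.log (Fintype.card V / Fintype.card Ω) := by
    refine sum_log_le_of_sum_le (fun w => ?_) (by positivity) ?_
    · exact div_pos (mul_pos (ha _) (hb _)) (mul_pos (hαpos w) (hβpos w))
    · rw [mul_div_cancel₀ _ hΩ.ne', ← Finset.sum_fiberwise Finset.univ v]
      calc _ ≤ ∑ _x : V, (1 : ℝ) := Finset.sum_le_sum fun x _ => ?_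
        _ = _ := by simp
      have h1 : ∑ w with v w = x, a (P w) * b (Q w) ≤ α x * β x := by
        rw [hαdef, hβdef, Finset.sum_mul_sum, ← Finset.sum_product',
          ← Finset.sum_image (f := fun p : A × B => a p.1 * b p.2) (g := fun w => (P w, Q w))]
        · refine Finset.sum_le_sum_of_subset_of_nonneg ?_
            fun p _ _ => (mul_pos (ha _) (hb _)).le
          intro p hp
          obtain ⟨w, hw, rfl⟩ := Finset.mem_image.1 hp
          exact Finset.mem_product.2
            ⟨Finset.mem_image_of_mem _ hw, Finset.mem_image_of_mem _ hw⟩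
        · intro w _ w' _ h
          exact hPQ _ _ (congrArg Prod.fst h) (congrArg Prod.snd h)
      calc ∑ w with v w = x, a (P w) * b (Q w) / (α (v w) * β (v w))
          = (∑ w with v w = x, a (P w) * b (Q w)) / (α x * β x) := by
            rw [Finset.sum_div]
            exact Finset.sum_congr rfl fun w hw => by rw [(Finset.mem_filter.1 hw).2]
        _ ≤ 1 := div_le_one_of_le₀ h1 (mul_nonneg
            (Finset.sum_nonneg fun p _ => (ha p).le) (Finset.sum_nonneg fun p _ => (hb p).le))
  have hsplit : ∀ w, Real.log (a (P w)) + Real.log (b (Q w)) =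
      Real.log (a (P w) * b (Q w) / (α (v w) * β (v w))) + Real.log (α (v w))
        + Real.log (β (v w)) := fun w => by
    have h1 := (ha (P w)).ne'
    have h2 := (hb (Q w)).ne'
    have h3 := (hαpos w).ne'
    have h4 := (hβpos w).ne'
    rw [Real.log_div (mul_ne_zero h1 h2) (mul_ne_zero h3 h4), Real.log_mul h1 h2,
      Real.log_mul h3 h4]
    ring
  rw [Real.log_div hCa.ne' hV.ne'] at hA
  rw [Real.log_div hCb.ne' hV.ne'] at hB
  rw [Real.log_div hV.ne' hΩ.ne'] at hC
  rw [← Finset.sum_add_distrib, Finset.sum_congr rfl fun w _ => hsplit w,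
    Finset.sum_add_distrib, Finset.sum_add_distrib]
  linarith

/-! ### Weights of binary words -/

/-- A subprobability on the binary words, geometric in the length and uniform given the length. -/
noncomputable def wordWeight (t : ℝ) (y : List Bool) : ℝ := (1 - t) * (t / 2) ^ y.length

lemma wordWeight_pos {t : ℝ} (h0 : 0 < t) (h1 : t < 1) (y : List Bool) : 0 < wordWeight t y :=
  mul_pos (by linarith) (by positivity)

/-- There are at most `2 ^ l` words of length `l`, so they weigh at most `(1 - t) * t ^ l`, a
geometric series. No prefix condition on the words is needed. -/
lemma sum_wordWeight_le_one {t : ℝ} (h0 : 0 < t) (h1 : t < 1) (S : Finset (List Bool)) :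
    ∑ y ∈ S, wordWeight t y ≤ 1 := by
  set N := S.sup List.length + 1
  have hmaps : ∀ y ∈ S, y.length ∈ Finset.range N := fun y hy =>
    Finset.mem_range.2 (Nat.lt_succ_of_le (Finset.le_sup (f := List.length) hy))
  have hcard : ∀ l, (S.filter fun y => y.length = l).card ≤ 2 ^ l := fun l => by
    have : (S.filter fun y => y.length = l).card ≤
        (Finset.univ : Finset (Fin l → Bool)).card := by
      refine Finset.card_le_card_of_injOn (fun y j => y.getD j false) (fun _ _ => by simp) ?_
      intro y hy y' hy' h
      simp only [Finset.coe_filter, Set.mem_ofPred_eq] at hy hy'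
      refine List.ext_getElem (hy.2.trans hy'.2.symm) fun j hj hj' => ?_
      have := congrFun h ⟨j, hy.2 ▸ hj⟩
      beta_reduce at this
      rwa [List.getD_eq_getElem _ _ hj, List.getD_eq_getElem _ _ hj'] at this
    simpa using this
  calc ∑ y ∈ S, wordWeight t y
      = ∑ l ∈ Finset.range N, ∑ y ∈ S with y.length = l, wordWeight t y :=
        (Finset.sum_fiberwise_of_maps_to hmaps _).symm
    _ ≤ ∑ l ∈ Finset.range N, (1 - t) * t ^ l := by
        refine Finset.sum_le_sum fun l _ => ?_
        calc ∑ y ∈ S with y.length = l, wordWeight t y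
            = ((S.filter fun y => y.length = l).card : ℝ) * ((1 - t) * (t / 2) ^ l) := by
              rw [← nsmul_eq_mul, ← Finset.sum_const]
              exact Finset.sum_congr rfl fun y hy => by
                rw [wordWeight, (Finset.mem_filter.1 hy).2]
          _ ≤ (2 : ℝ) ^ l * ((1 - t) * (t / 2) ^ l) := by
              refine mul_le_mul_of_nonneg_right (by exact_mod_cast hcard l) ?_
              exact mul_nonneg (by linarith) (by positivity)
          _ = (1 - t) * t ^ l := by rw [div_pow]; field_simp
    _ = 1 - t ^ N := by
        rw [← Finset.mul_sum]
        have := mul_neg_geom_sum t N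
        linarith
    _ ≤ 1 := by linarith [pow_nonneg h0.le N]

/-- The cache component gets counting measure, so a cache of `c` bits contributes exactly `c * log
2` to the logarithm of the total weight. -/
lemma sum_wordWeight_fst_le {t : ℝ} (h0 : 0 < t) (h1 : t < 1) {Z : Type*} [Fintype Z]
    (S : Finset (List Bool × Z)) : ∑ p ∈ S, wordWeight t p.1 ≤ Fintype.card Z := by
  classical
  calc ∑ p ∈ S, wordWeight t p.1
      ≤ ∑ p ∈ (S.image Prod.fst) ×ˢ (Finset.univ : Finset Z), wordWeight t p.1 := by
        refine Finset.sum_le_sum_of_subset_of_nonneg (fun p hp => ?_)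
          fun p _ _ => (wordWeight_pos h0 h1 _).le
        exact Finset.mem_product.2 ⟨Finset.mem_image_of_mem _ hp, Finset.mem_univ _⟩
    _ = (∑ y ∈ S.image Prod.fst, wordWeight t y) * Fintype.card Z := by
        rw [Finset.sum_product, Finset.sum_mul]
        simp [mul_comm]
    _ ≤ 1 * Fintype.card Z := by
        gcongr
        exact sum_wordWeight_le_one h0 h1 _
    _ = _ := one_mul _

/-- Each bit costs `log (2 / t)`, close to `log 2` for `t` near `1`; the price is the constant `-log
(1 - t)`, which disappears after division by the file size. -/
lemma sum_log_wordWeight {Ω : Type*} [Fintype Ω] {t : ℝ} (h0 : 0 < t) (h1 : t < 1)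
    (Y : Ω → List Bool) :
    ∑ w, Real.log (wordWeight t (Y w)) =
      Fintype.card Ω * Real.log (1 - t) - (∑ w, ((Y w).length : ℝ)) * Real.log (2 / t) := by
  have h2 : ∀ w, Real.log (wordWeight t (Y w)) =
      Real.log (1 - t) - (Y w).length * Real.log (2 / t) := fun w => by
    rw [wordWeight, Real.log_mul (by linarith) (by positivity), Real.log_pow, ← inv_div 2 t,
      Real.log_inv]
    ring
  rw [Finset.sum_congr rfl fun w _ => h2 w, Finset.sum_sub_distrib, Finset.sum_mul]
  simp

/-! ### Converse bounds for codes without errors -/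

/-- From the codeword and its cache, each receiver can recover both descriptions that it wants. -/
def Recovers {K c : ℕ} {n : Fin 3 → ℕ} (Y : Demand K → Library n → List Bool)
    (Z : Fin K → Library n → Cache c) : Prop :=
  ∀ d k w w', Y d w = Y d w' → Z k w = Z k w' → w 0 = w' 0 ∧ w (d k).succ = w' (d k).succ

/-- Mean length of a word that depends on the library. -/
noncomputable def meanLength {n : Fin 3 → ℕ} (y : Library n → List Bool) : ℝ :=
  (∑ w, ((y w).length : ℝ)) / Fintype.card (Library n)

lemma library_ext {n : Fin 3 → ℕ} {w w' : Library n} {i j : Fin 2} (hij : i ≠ j)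
    (h0 : w 0 = w' 0) (hi : w i.succ = w' i.succ) (hj : w j.succ = w' j.succ) : w = w' := by
  funext s
  refine Fin.cases h0 (fun a => ?_) s
  have : a = i ∨ a = j := by omega
  rcases this with rfl | rfl <;> assumption

lemma card_library (n : Fin 3 → ℕ) : Fintype.card (Library n) = 2 ^ (n 0 + n 1 + n 2) := by
  simp [Library, Fintype.card_pi, Fin.prod_univ_succ, pow_add, mul_assoc]

lemma log_card_library (n : Fin 3 → ℕ) :
    Real.log (Fintype.card (Library n)) = ((n 0 : ℝ) + n 1 + n 2) * Real.log 2 := by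
  rw [card_library, Nat.cast_pow, Real.log_pow]
  push_cast
  ring

section Converse

variable {K c : ℕ} {n : Fin 3 → ℕ} {Y : Demand K → Library n → List Bool}
  {Z : Fin K → Library n → Cache c} {t : ℝ}

/-- One receiver that recovers the whole library from two codewords. -/
lemma Recovers.one_receiver (hr : Recovers Y Z) (h0 : 0 < t) (h1 : t < 1) {d d' : Demand K}
    {k : Fin K} (hk : d k ≠ d' k) :
    ((n 0 : ℝ) + n 1 + n 2 - c) * Real.log 2 ≤
      (meanLength (Y d) + meanLength (Y d')) * Real.log (2 / t) - 2 * Real.log (1 - t) := by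
  have hΩ : (0 : ℝ) < Fintype.card (Library n) := by exact_mod_cast Fintype.card_pos
  have hinj : Function.Injective fun w : Library n => (Y d w, (Y d' w, Z k w)) := by
    intro w w' h
    simp only [Prod.mk.injEq] at h
    exact library_ext hk (hr d k w w' h.1 h.2.2).1 (hr d k w w' h.1 h.2.2).2
      (hr d' k w w' h.2.1 h.2.2).2
  have := sum_log_le_of_injective hinj
    (a := fun p => wordWeight t p.1 * wordWeight t p.2.1)
    (fun p => mul_pos (wordWeight_pos h0 h1 _) (wordWeight_pos h0 h1 _))
    (Ca := Fintype.card (Cache c)) (by exact_mod_cast Fintype.card_pos) (by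
      classical
      intro S
      calc ∑ p ∈ S, wordWeight t p.1 * wordWeight t p.2.1
          ≤ ∑ p ∈ (S.image Prod.fst) ×ˢ (S.image Prod.snd),
              wordWeight t p.1 * wordWeight t p.2.1 := by
            refine Finset.sum_le_sum_of_subset_of_nonneg (fun p hp => ?_)
              fun p _ _ => (mul_pos (wordWeight_pos h0 h1 _) (wordWeight_pos h0 h1 _)).le
            exact Finset.mem_product.2
              ⟨Finset.mem_image_of_mem _ hp, Finset.mem_image_of_mem _ hp⟩
        _ = (∑ y ∈ S.image Prod.fst, wordWeight t y) *
              ∑ p ∈ S.image Prod.snd, wordWeight t p.1 := by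
            rw [Finset.sum_product, Finset.sum_mul_sum]
        _ ≤ 1 * Fintype.card (Cache c) := by
            refine mul_le_mul (sum_wordWeight_le_one h0 h1 _) (sum_wordWeight_fst_le h0 h1 _)
              (Finset.sum_nonneg fun p _ => (wordWeight_pos h0 h1 _).le) zero_le_one
        _ = _ := one_mul _)
  simp only [Real.log_mul (wordWeight_pos h0 h1 _).ne' (wordWeight_pos h0 h1 _).ne',
    Finset.sum_add_distrib, sum_log_wordWeight h0 h1, log_card_library] at this
  have hc : Real.log (Fintype.card (Cache c)) = c * Real.log 2 := by simp [Cache]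
  rw [hc] at this
  rw [meanLength, meanLength, ← add_div, div_mul_eq_mul_div, le_sub_iff_add_le, le_div_iff₀ hΩ]
  linarith

/-- Two receivers that recover the whole library from one codeword, one of which also recovers the
same file as the other one from a second codeword. -/
lemma Recovers.two_receivers (hr : Recovers Y Z) (h0 : 0 < t) (h1 : t < 1) {d d' : Demand K}
    {k l : Fin K} (hk : d k ≠ d l) (hl : d' l = d k) :
    (2 * (n 0 : ℝ) + n 1 + n 2 + n (d k).succ - 2 * c) * Real.log 2 ≤
      (meanLength (Y d) + meanLength (Y d')) * Real.log (2 / t) - 2 * Real.log (1 - t) := by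
  have hΩ : (0 : ℝ) < Fintype.card (Library n) := by exact_mod_cast Fintype.card_pos
  have hcard : (0 : ℝ) < Fintype.card (Cache c) := by exact_mod_cast Fintype.card_pos
  have hcases : (d k = 0 ∧ d l = 1) ∨ (d k = 1 ∧ d l = 0) := by omega
  -- The shared part `v` consists of the common description and the file-`d k` private one. Jointly,
  -- `Z l` from `Q` and `Y d` from `P` supply the other private description, whose number of values
  -- is the fibre size `m`.
  have := sum_log_add_sum_log_le (Ω := Library n)
    (P := fun w => (Y d w, Z k w)) (Q := fun w => (Y d' w, Z l w))
    (v := fun w => (w 0, w (d k).succ)) (m := 2 ^ n (d l).succ)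
    (a := fun p => wordWeight t p.1) (b := fun p => wordWeight t p.1)
    (fun w w' h => by
      simp only [Prod.mk.injEq] at h
      exact Prod.ext (hr d k w w' h.1 h.2).1 (hr d k w w' h.1 h.2).2)
    (fun w w' h => by
      simp only [Prod.mk.injEq] at h
      have := hr d' l w w' h.1 h.2
      rw [hl] at this
      exact Prod.ext this.1 this.2)
    (fun w w' h h' => by
      simp only [Prod.mk.injEq] at h h'
      exact library_ext hk (hr d k w w' h.1 h.2).1 (hr d k w w' h.1 h.2).2
        (hr d l w w' h.1 h'.2).2)
    (fun p => wordWeight_pos h0 h1 _) (fun p => wordWeight_pos h0 h1 _) hcard hcard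
    (sum_wordWeight_fst_le h0 h1) (sum_wordWeight_fst_le h0 h1)
    (fun x => by
      have : Function.Injective fun w : {w : Library n // (w 0, w (d k).succ) = x} =>
          w.1 (d l).succ := by
        rintro ⟨w, hw⟩ ⟨w', hw'⟩ h
        have h2 := hw.trans hw'.symm
        simp only [Prod.mk.injEq] at h2
        exact Subtype.ext (library_ext hk h2.1 h2.2 h)
      simpa using Nat.card_le_card_of_injective _ this)
    (by
      rw [card_library]
      rcases hcases with ⟨h, h'⟩ | ⟨h, h'⟩ <;> simp [h, h'] <;> ring)
  simp only [sum_log_wordWeight h0 h1, log_card_library] at this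
  have hc : Real.log (Fintype.card (Cache c)) = c * Real.log 2 := by simp [Cache]
  have hv : Real.log (Fintype.card ((Fin (n 0) → Bool) × (Fin (n (d k).succ) → Bool))) =
      ((n 0 : ℝ) + n (d k).succ) * Real.log 2 := by
    rw [Fintype.card_prod]
    simp [← pow_add]
  rw [hc, hv] at this
  rw [meanLength, meanLength, ← add_div, div_mul_eq_mul_div, le_sub_iff_add_le, le_div_iff₀ hΩ]
  linarith

end Converse

end CodedCaching

namespace CodedCaching

/-! ### Averaging the converse bounds over the demands -/

section Averaging

variable {K c : ℕ} {n : Fin 3 → ℕ} {Y : Demand K → Library n → List Bool}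
  {Z : Fin K → Library n → Cache c} {t : ℝ}

/-- Mean codeword length for a uniform demand. -/
noncomputable def avgLength (Y : Demand K → Library n → List Bool) : ℝ :=
  (∑ d, meanLength (Y d)) / Fintype.card (Demand K)

/-- Change the requests of the receivers `k` and `l` by `a` and `b`. -/
def shiftDemand (k l : Fin K) (a b : Fin 2) : Demand K ≃ Demand K :=
  Equiv.addRight (Pi.single k a + Pi.single l b)

/-- A bound that holds for the four joint requests of two receivers, whatever the others request,
holds on average. -/
lemma le_four_mul_avg {k l : Fin K} (hkl : k ≠ l) (f : Demand K → ℝ) {x : ℝ}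
    (h : ∀ e : Fin 2 → Fin 2 → Demand K, (∀ a b, e a b k = a) → (∀ a b, e a b l = b) →
      x ≤ f (e 0 0) + f (e 0 1) + f (e 1 0) + f (e 1 1)) :
    x ≤ 4 * ((∑ d, f d) / Fintype.card (Demand K)) := by
  have hcard : (0 : ℝ) < Fintype.card (Demand K) := by exact_mod_cast Fintype.card_pos
  have h1 : ∀ d : Demand K, x ≤ ∑ a, ∑ b, f (shiftDemand k l a b d) := fun d => by
    have h2 := h (fun a b => shiftDemand k l (a - d k) (b - d l) d)
      (fun a b => by simp [shiftDemand, hkl])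
      (fun a b => by simp [shiftDemand, hkl.symm])
    -- Prescribing the two requests and shifting them in all possible ways run through the same four
    -- demands, only in a different order.
    have h3 : ∑ a, ∑ b, f (shiftDemand k l (a - d k) (b - d l) d) =
        ∑ a, ∑ b, f (shiftDemand k l a b d) := by
      rw [← (Equiv.subRight (d k)).sum_comp fun a => ∑ b, f (shiftDemand k l a b d)]
      refine Finset.sum_congr rfl fun a _ => ?_
      exact (Equiv.subRight (d l)).sum_comp fun b => f (shiftDemand k l (a - d k) b d)
    rw [← h3]
    simp only [Fin.sum_univ_two]
    linarith
  have h4 : Fintype.card (Demand K) * x ≤ 4 * ∑ d, f d := by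
    calc Fintype.card (Demand K) * x = ∑ _d : Demand K, x := by simp
      _ ≤ ∑ d, ∑ a, ∑ b, f (shiftDemand k l a b d) := Finset.sum_le_sum fun d _ => h1 d
      _ = ∑ a, ∑ b, ∑ d, f (shiftDemand k l a b d) := by
          rw [Finset.sum_comm]
          exact Finset.sum_congr rfl fun a _ => Finset.sum_comm
      _ = 4 * ∑ d, f d := by
          simp only [Equiv.sum_comp, Fin.sum_univ_two]
          ring
  rw [← mul_div_assoc, le_div_iff₀ hcard]
  linarith

/-- Bound on the average length of a code without errors, up to lower-order terms, by a linear
combination of the description lengths and the cache length. -/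
def LengthBound (α : Fin 3 → ℝ) (β : ℝ) : Prop :=
  ∀ ⦃K c : ℕ⦄ ⦃n : Fin 3 → ℕ⦄ ⦃Y : Demand K → Library n → List Bool⦄
    ⦃Z : Fin K → Library n → Cache c⦄ ⦃t : ℝ⦄, 2 ≤ K → Recovers Y Z → 0 < t → t < 1 →
    (∑ s, α s * n s - β * c) * Real.log 2 ≤
      4 * avgLength Y * Real.log (2 / t) - 4 * Real.log (1 - t)

lemma lengthBound_of_four {α : Fin 3 → ℝ} {β : ℝ}
    (h : ∀ ⦃K c : ℕ⦄ ⦃n : Fin 3 → ℕ⦄ ⦃Y : Demand K → Library n → List Bool⦄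
      ⦃Z : Fin K → Library n → Cache c⦄ ⦃t : ℝ⦄, Recovers Y Z → 0 < t → t < 1 →
      ∀ (k l : Fin K) (e : Fin 2 → Fin 2 → Demand K),
      (∀ a b, e a b k = a) → (∀ a b, e a b l = b) →
      (∑ s, α s * n s - β * c) * Real.log 2 ≤
        (meanLength (Y (e 0 0)) + meanLength (Y (e 0 1)) + meanLength (Y (e 1 0)) +
          meanLength (Y (e 1 1))) * Real.log (2 / t) - 4 * Real.log (1 - t)) :
    LengthBound α β := by
  intro K c n Y Z t hK hr h0 h1
  have hlog : 0 < Real.log (2 / t) := Real.log_pos (by rw [lt_div_iff₀ h0]; linarith)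
  have := le_four_mul_avg (k := (⟨0, by omega⟩ : Fin K)) (l := ⟨1, by omega⟩) (by simp)
    (fun d => meanLength (Y d))
    (x := ((∑ s, α s * n s - β * c) * Real.log 2 + 4 * Real.log (1 - t)) / Real.log (2 / t))
    (fun e hk hl => by
      rw [div_le_iff₀ hlog]
      linarith [h hr h0 h1 _ _ e hk hl])
  rw [div_le_iff₀ hlog] at this
  rw [avgLength]
  linarith

/-- Two submodularity bounds use each of the four joint requests once; private description `1` is
shared in one of them and `2` in the other. -/
lemma lengthBound_two_receivers : LengthBound ![4, 3, 3] 4 :=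
  lengthBound_of_four fun K c n Y Z t hr h0 h1 k l e hk hl => by
    have hA := hr.two_receivers h0 h1 (d := e 0 1) (d' := e 0 0) (k := k) (l := l)
      (by simp [hk, hl]) (by simp [hk, hl])
    have hB := hr.two_receivers h0 h1 (d := e 1 0) (d' := e 1 1) (k := k) (l := l)
      (by simp [hk, hl]) (by simp [hk, hl])
    simp only [hk, Fin.succ_zero_eq_one, Fin.succ_one_eq_two] at hA hB
    simp only [Fin.sum_univ_three, Matrix.cons_val]
    linarith

lemma lengthBound_one_receiver : LengthBound ![2, 2, 2] 2 :=
  lengthBound_of_four fun K c n Y Z t hr h0 h1 k l e hk hl => by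
    have hA := hr.one_receiver h0 h1 (d := e 0 1) (d' := e 1 0) (k := k) (by simp [hk])
    have hB := hr.one_receiver h0 h1 (d := e 0 0) (d' := e 1 1) (k := k) (by simp [hk])
    simp only [Fin.sum_univ_three, Matrix.cons_val]
    linarith

/-- One submodularity bound sharing private description `2`, plus a one-receiver bound on the two
remaining demands. With its mirror image it settles the memory range where neither pure bound is
strong enough for the gap. -/
lemma lengthBound_mixed_two : LengthBound ![3, 2, 3] 3 :=
  lengthBound_of_four fun K c n Y Z t hr h0 h1 k l e hk hl => by
    have hA := hr.two_receivers h0 h1 (d := e 1 0) (d' := e 1 1) (k := k) (l := l)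
      (by simp [hk, hl]) (by simp [hk, hl])
    have hB := hr.one_receiver h0 h1 (d := e 0 1) (d' := e 0 0) (k := l) (by simp [hl])
    simp only [hk, Fin.succ_one_eq_two] at hA
    simp only [Fin.sum_univ_three, Matrix.cons_val]
    linarith

lemma lengthBound_mixed_one : LengthBound ![3, 3, 2] 3 :=
  lengthBound_of_four fun K c n Y Z t hr h0 h1 k l e hk hl => by
    have hA := hr.two_receivers h0 h1 (d := e 0 1) (d' := e 0 0) (k := k) (l := l)
      (by simp [hk, hl]) (by simp [hk, hl])
    have hB := hr.one_receiver h0 h1 (d := e 1 0) (d' := e 1 1) (k := l) (by simp [hl])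
    simp only [hk, Fin.succ_zero_eq_one] at hA
    simp only [Fin.sum_univ_three, Matrix.cons_val]
    linarith

end Averaging

/-! ### Removing the errors of a scheme -/

/-- The library written as one word. -/
def libraryWord {n : Fin 3 → ℕ} (w : Library n) : List Bool :=
  List.ofFn (w 0) ++ List.ofFn (w 1) ++ List.ofFn (w 2)

lemma libraryWord_injective {n : Fin 3 → ℕ} :
    Function.Injective (libraryWord : Library n → List Bool) := by
  intro w w' h
  obtain ⟨h1, h2⟩ := List.append_inj h (by simp)
  obtain ⟨h3, h4⟩ := List.append_inj h1 (by simp)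
  exact library_ext (i := 0) (j := 1) (by simp) (List.ofFn_injective h3)
    (List.ofFn_injective h4) (List.ofFn_injective h2)

namespace MRScheme

variable {K c : ℕ} {n : Fin 3 → ℕ} (C : MRScheme K n c)

open Classical in
/-- The codeword, preceded by a flag and replaced by the whole library if some receiver fails. -/
noncomputable def safeWord (d : Demand K) (w : Library n) : List Bool :=
  if C.Fails d w then true :: libraryWord w else false :: C.codeword d w

/-- The flag separates the two kinds of words. Without failure the scheme's own decoder is correct
on both libraries; with failure the word contains the library. -/
lemma recovers_safeWord : Recovers C.safeWord C.cache := by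
  intro d k w w' hY hZ
  by_cases h : C.Fails d w <;> by_cases h' : C.Fails d w' <;> simp [safeWord, h, h'] at hY
  · rw [libraryWord_injective hY]
    exact ⟨rfl, rfl⟩
  · simp only [Fails, not_exists, not_not] at h h'
    have h1 := h k
    rw [hY, hZ, h' k] at h1
    simpa [eq_comm] using h1

lemma card_fails_le (d : Demand K) :
    (Nat.card {w : Library n // C.Fails d w} : ℝ) ≤ C.errorProb * Fintype.card (Library n) := by
  have hΩ : (0 : ℝ) < Fintype.card (Library n) := by exact_mod_cast Fintype.card_pos
  have h : (Nat.card {w : Library n // C.Fails d w} : ℝ) / Nat.card (Library n) ≤ C.errorProb :=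
    le_ciSup (f := fun d => (Nat.card {w : Library n // C.Fails d w} : ℝ) / Nat.card (Library n))
      (Set.finite_range _).bddAbove d
  rwa [Nat.card_eq_fintype_card (α := Library n), div_le_iff₀ hΩ] at h

lemma avgLength_safeWord_le :
    avgLength C.safeWord ≤ C.expectedLength + 1 + C.errorProb * ((n 0 : ℝ) + n 1 + n 2) := by
  classical
  have hΩ : (0 : ℝ) < Fintype.card (Library n) := by exact_mod_cast Fintype.card_pos
  have hD : (0 : ℝ) < Fintype.card (Demand K) := by exact_mod_cast Fintype.card_pos
  have h1 : ∀ d w, ((C.safeWord d w).length : ℝ) ≤ (C.codeword d w).length + 1 +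
      (if C.Fails d w then 1 else 0) * ((n 0 : ℝ) + n 1 + n 2) := fun d w => by
    by_cases h : C.Fails d w
    · simp [safeWord, h, libraryWord]
      linarith [Nat.cast_nonneg (α := ℝ) (C.codeword d w).length]
    · simp [safeWord, h]
  have h2 : ∀ d, ∑ w, (if C.Fails d w then (1 : ℝ) else 0) ≤
      C.errorProb * Fintype.card (Library n) := fun d => by
    have := C.card_fails_le d
    rw [Nat.card_eq_fintype_card, Fintype.card_subtype] at this
    simpa using this
  have h3 : ∀ d, meanLength (C.safeWord d) ≤ (∑ w, ((C.codeword d w).length : ℝ)) /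
      Fintype.card (Library n) + (1 + C.errorProb * ((n 0 : ℝ) + n 1 + n 2)) := fun d => by
    rw [meanLength, div_le_iff₀ hΩ, add_mul, div_mul_cancel₀ _ hΩ.ne']
    calc _ ≤ ∑ w, (((C.codeword d w).length : ℝ) + 1 +
          (if C.Fails d w then 1 else 0) * ((n 0 : ℝ) + n 1 + n 2)) :=
          Finset.sum_le_sum fun w _ => h1 d w
      _ = (∑ w, ((C.codeword d w).length : ℝ)) + Fintype.card (Library n) +
          (∑ w, if C.Fails d w then (1 : ℝ) else 0) * ((n 0 : ℝ) + n 1 + n 2) := by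
          rw [Finset.sum_add_distrib, Finset.sum_add_distrib, Finset.sum_mul]
          simp
      _ ≤ (∑ w, ((C.codeword d w).length : ℝ)) + Fintype.card (Library n) +
          (C.errorProb * Fintype.card (Library n)) * ((n 0 : ℝ) + n 1 + n 2) := by
          gcongr
          exact h2 d
      _ = _ := by ring
  rw [avgLength, div_le_iff₀ hD, expectedLength]
  calc _ ≤ ∑ d, ((∑ w, ((C.codeword d w).length : ℝ)) /
      Fintype.card (Library n) + (1 + C.errorProb * ((n 0 : ℝ) + n 1 + n 2))) :=
        Finset.sum_le_sum fun d _ => h3 d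
    _ = _ := by
      rw [Finset.sum_add_distrib, ← Finset.sum_div]
      simp only [Finset.sum_const, Finset.card_univ, nsmul_eq_mul]
      field_simp
      ring

end MRScheme

/-! ### Converse bounds for the rate-memory region -/

lemma tendsto_natFloor_natCast_mul_div {x : ℝ} (hx : 0 ≤ x) :
    Tendsto (fun F : ℕ => (⌊(F : ℝ) * x⌋₊ : ℝ) / F) atTop (𝓝 x) := by
  have := (tendsto_nat_floor_mul_div_atTop hx).comp (tendsto_natCast_atTop_atTop (R := ℝ))
  refine this.congr fun F => ?_
  simp [mul_comm]

lemma LengthBound.le_of_achievable {α : Fin 3 → ℝ} {β : ℝ} (h : LengthBound α β) {K : ℕ}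
    (hK : 2 ≤ K) {ρ : Fin 3 → ℝ} (hρ : ∀ s, 0 ≤ ρ s) {R M : ℝ} (ha : Achievable K ρ R M) :
    ∑ s, α s * ρ s - β * M ≤ 4 * R := by
  obtain ⟨hM, C, herr, hlim⟩ := ha
  have hlog2 : 0 < Real.log 2 := Real.log_pos one_lt_two
  -- First `F → ∞` for fixed `t`, which removes the terms in `log (1 - t)` and the error
  -- probability; then `t → 1`. The slack `1 - t` in the rate makes the limit superior bound hold
  -- eventually and vanishes with the second limit.
  have key : ∀ t ∈ Set.Ioo (0 : ℝ) 1,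
      (∑ s, α s * ρ s - β * M) * Real.log 2 ≤ 4 * (R + (1 - t)) * Real.log (2 / t) := by
    rintro t ⟨h0, h1⟩
    have hlog : 0 < Real.log (2 / t) := Real.log_pos (by rw [lt_div_iff₀ h0]; linarith)
    have hlt : ∀ᶠ F in atTop, avgRate (C F) < R + (1 - t) := by
      have : limsup (fun F => ((avgRate (C F) : ℝ) : EReal)) atTop < ((R + (1 - t) : ℝ) : EReal) :=
        lt_of_le_of_lt hlim (by exact_mod_cast (by linarith : R < R + (1 - t)))
      filter_upwards [eventually_lt_of_limsup_lt this] with F hF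
      exact_mod_cast hF
    have hinv : Tendsto (fun F : ℕ => (1 : ℝ) / F) atTop (𝓝 0) :=
      tendsto_const_div_atTop_nhds_zero_nat 1
    have hdesc : ∀ s, Tendsto (fun F : ℕ => (descLength ρ F s : ℝ) / F) atTop (𝓝 (ρ s)) :=
      fun s => tendsto_natFloor_natCast_mul_div (hρ s)
    have hL : Tendsto (fun F : ℕ => (∑ s, α s * ((descLength ρ F s : ℝ) / F) -
        β * ((cacheLength M F : ℝ) / F)) * Real.log 2) atTop
        (𝓝 ((∑ s, α s * ρ s - β * M) * Real.log 2)) :=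
      ((tendsto_finsetSum _ fun s _ => (hdesc s).const_mul _).sub
        ((tendsto_natFloor_natCast_mul_div hM).const_mul _)).mul_const _
    have hR : Tendsto (fun F : ℕ => 4 * (R + (1 - t) + 1 / F + (C F).errorProb *
        ((descLength ρ F 0 : ℝ) / F + (descLength ρ F 1 : ℝ) / F + (descLength ρ F 2 : ℝ) / F)) *
        Real.log (2 / t) - 4 * Real.log (1 - t) * (1 / F)) atTop
        (𝓝 (4 * (R + (1 - t) + 0 + 0 * (ρ 0 + ρ 1 + ρ 2)) * Real.log (2 / t) -
          4 * Real.log (1 - t) * 0)) :=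
      ((((tendsto_const_nhds.add hinv).add (herr.mul (((hdesc 0).add (hdesc 1)).add
        (hdesc 2)))).const_mul _).mul_const _).sub (hinv.const_mul _)
    have hle := le_of_tendsto_of_tendsto hL hR (by
      filter_upwards [hlt, eventually_gt_atTop 0] with F hF hF0
      have hFpos : (0 : ℝ) < F := by exact_mod_cast hF0
      have h2 := h hK (C F).recovers_safeWord h0 h1
      have h3 := (C F).avgLength_safeWord_le
      have h4 : (C F).expectedLength ≤ (R + (1 - t)) * F := by
        rw [avgRate, div_lt_iff₀ hFpos] at hF
        exact hF.le
      have h5 : (∑ s, α s * (descLength ρ F s : ℝ) - β * cacheLength M F) * Real.log 2 ≤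
          4 * ((R + (1 - t)) * F + 1 + (C F).errorProb * ((descLength ρ F 0 : ℝ) +
            descLength ρ F 1 + descLength ρ F 2)) * Real.log (2 / t) - 4 * Real.log (1 - t) := by
        refine h2.trans ?_
        gcongr
        linarith
      have h6 := div_le_div_of_nonneg_right h5 hFpos.le
      convert h6 using 1
      · simp only [Fin.sum_univ_three]
        field_simp
      · field_simp)
    simpa using hle
  have hT : Tendsto (fun t : ℝ => 4 * (R + (1 - t)) * Real.log (2 / t)) (𝓝[<] 1)
      (𝓝 (4 * (R + (1 - 1)) * Real.log (2 / 1))) := by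
    have : ContinuousAt (fun t : ℝ => 4 * (R + (1 - t)) * Real.log (2 / t)) 1 := by
      fun_prop (disch := norm_num)
    exact this.tendsto.mono_left nhdsWithin_le_nhds
  have hfin := ge_of_tendsto hT (by
    filter_upwards [Ioo_mem_nhdsLT (zero_lt_one (α := ℝ))] with t ht using key t ht)
  simp only [sub_self, add_zero, div_one] at hfin
  exact le_of_mul_le_mul_right hfin hlog2

lemma LengthBound.le_of_mem_region {α : Fin 3 → ℝ} {β : ℝ} (h : LengthBound α β) {K : ℕ}
    (hK : 2 ≤ K) {ρ : Fin 3 → ℝ} (hρ : ∀ s, 0 ≤ ρ s) {R M : ℝ} (hm : (R, M) ∈ region K ρ) :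
    ∑ s, α s * ρ s - β * M ≤ 4 * R := by
  have hcl : IsClosed {p : ℝ × ℝ | ∑ s, α s * ρ s - β * p.2 ≤ 4 * p.1} :=
    isClosed_le (by fun_prop) (by fun_prop)
  exact closure_minimal (fun p hp => h.le_of_achievable hK hρ hp) hcl hm

lemma avgRate_nonneg {K : ℕ} {ρ : Fin 3 → ℝ} {M : ℝ} {F : ℕ} (C : MRSchemeAt K ρ M F) :
    0 ≤ avgRate C := by
  unfold avgRate MRScheme.expectedLength
  positivity

lemma nonneg_of_mem_region {K : ℕ} {ρ : Fin 3 → ℝ} {R M : ℝ} (hm : (R, M) ∈ region K ρ) :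
    0 ≤ R := by
  have hcl : IsClosed {p : ℝ × ℝ | 0 ≤ p.1} := isClosed_le (by fun_prop) (by fun_prop)
  refine closure_minimal (fun p hp => ?_) hcl hm
  obtain ⟨-, C, -, hlim⟩ := hp
  have h0 : (0 : EReal) ≤ limsup (fun F => ((avgRate (C F) : ℝ) : EReal)) atTop :=
    le_limsup_of_frequently_le
      (Eventually.of_forall fun F => by exact_mod_cast avgRate_nonneg (C F)).frequently
  exact_mod_cast h0.trans hlim

lemma optimalRate_le {K : ℕ} {ρ : Fin 3 → ℝ} {R M : ℝ} (h : Achievable K ρ R M) :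
    optimalRate K ρ M ≤ R :=
  csInf_le ⟨0, fun _ hr => nonneg_of_mem_region hr⟩ (subset_closure h)

/-- The achievable pair shows that the set of rates is nonempty; the real infimum of the empty set
would be the junk value `0`. -/
lemma le_optimalRate {K : ℕ} {ρ : Fin 3 → ℝ} {R M x : ℝ} (h : Achievable K ρ R M)
    (hx : ∀ r, (r, M) ∈ region K ρ → x ≤ r) : x ≤ optimalRate K ρ M :=
  le_csInf ⟨R, subset_closure h⟩ fun r hr => hx r hr

end CodedCaching

namespace CodedCaching

/-! ### Correctness of the split schemes -/

lemma xorBits_comm (x y : List Bool) : xorBits x y = xorBits y x :=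
  List.zipWith_comm_of_comm fun a b => Bool.xor_comm a b

lemma length_xorBits (x y : List Bool) : (xorBits x y).length = min x.length y.length :=
  List.length_zipWith

lemma xorBits_left_cancel {x x' y : List Bool} (h : xorBits x y = xorBits x' y)
    (hx : x.length = y.length) (hx' : x'.length = y.length) : x = x' := by
  refine List.ext_getElem (hx.trans hx'.symm) fun j hj hj' => ?_
  have h1 : (xorBits x y)[j]'(by simp [xorBits]; omega) =
      (xorBits x' y)[j]'(by simp [xorBits]; omega) := by simp only [h]
  simpa [xorBits] using h1

lemma eq_of_flatMap_eq {α β : Type*} {f g : α → List β} :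
    ∀ {l : List α}, (∀ x ∈ l, (f x).length = (g x).length) → l.flatMap f = l.flatMap g →
      ∀ x ∈ l, f x = g x
  | [], _, _ => by simp
  | a :: l, hlen, h => by
    simp only [List.flatMap_cons] at h
    obtain ⟨h1, h2⟩ := List.append_inj h (hlen a (by simp))
    have := eq_of_flatMap_eq (fun x hx => hlen x (by simp [hx])) h2
    simpa [h1] using this

lemma length_foldl_xorBits {m : ℕ} :
    ∀ {L : List (List Bool)} {x : List Bool}, (∀ y ∈ L, y.length = m) → x.length = m →
      (L.foldl xorBits x).length = m
  | [], _, _, hx => hx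
  | y :: L, x, hL, hx => length_foldl_xorBits (x := xorBits x y) (fun z hz => hL z (by simp [hz]))
      (by rw [length_xorBits, hx, hL y (by simp), min_self])

lemma foldl_xorBits_left_cancel {m : ℕ} :
    ∀ {L : List (List Bool)} {x x' : List Bool}, (∀ y ∈ L, y.length = m) → x.length = m →
      x'.length = m → L.foldl xorBits x = L.foldl xorBits x' → x = x'
  | [], _, _, _, _, _, h => h
  | y :: L, x, x', hL, hx, hx', h => by
    have hy := hL y (by simp)
    exact xorBits_left_cancel (foldl_xorBits_left_cancel (x := xorBits x y)
      (x' := xorBits x' y) (fun z hz => hL z (by simp [hz])) (by rw [length_xorBits, hx, hy, min_self])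
      (by rw [length_xorBits, hx', hy, min_self]) h)
      (hx.trans hy.symm) (hx'.trans hy.symm)

/-- All summands but the one at `k` agree, so they cancel. The length hypotheses matter because
`zipWith` truncates to the shorter word. -/
lemma eq_of_foldl_xorBits_eq {α : Type*} {m : ℕ} {f g : α → List Bool} {k : α}
    (hf : ∀ a, (f a).length = m) (hg : ∀ a, (g a).length = m) (hfg : ∀ a, a ≠ k → f a = g a) :
    ∀ {l : List α} {x : List Bool}, l.Nodup → k ∈ l → x.length = m →
      (l.map f).foldl xorBits x = (l.map g).foldl xorBits x → f k = g k
  | [], _, _, hk, _, _ => by simp at hk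
  | a :: l, x, hl, hk, hx, h => by
    obtain ⟨hal, hl⟩ := List.nodup_cons.1 hl
    simp only [List.map_cons, List.foldl_cons] at h
    by_cases ha : a = k
    · subst ha
      have hmap : l.map f = l.map g := List.map_congr_left fun b hb => hfg b fun h => hal (h ▸ hb)
      rw [hmap] at h
      have := foldl_xorBits_left_cancel (m := m) (by simp [hg])
        (by rw [length_xorBits, hx, hf, min_self]) (by rw [length_xorBits, hx, hg, min_self]) h
      rw [xorBits_comm x, xorBits_comm x] at this
      exact xorBits_left_cancel this ((hf a).trans hx.symm) ((hg a).trans hx.symm)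
    · rw [hfg a ha] at h
      exact eq_of_foldl_xorBits_eq hf hg hfg hl
        (by simpa [Ne.symm ha] using hk) (by rw [length_xorBits, hx, hg, min_self]) h

section Split

variable {K : ℕ} {n : Fin 3 → ℕ} (p : Split)

@[simp] lemma length_bits (w : Library n) (s : Fin 3) (a m : ℕ) : (bits w s a m).length = m := by
  simp [bits]

lemma bit_eq_of_bits_eq {w w' : Library n} {s : Fin 3} {a m j : ℕ}
    (h : bits w s a m = bits w' s a m) (h1 : a ≤ j) (h2 : j < a + m) :
    bit w s j = bit w' s j := by
  have := List.map_inj_left.1 h (j - a) (List.mem_range.2 (by omega))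
  rwa [Nat.add_sub_cancel' h1] at this

lemma eq_of_bit_eq {w w' : Library n} {s : Fin 3} (h : ∀ j < n s, bit w s j = bit w' s j) :
    w s = w' s := by
  funext j
  simpa [bit] using h j j.2

@[simp] lemma length_singlePacket (w : Library n) (i : Fin 2) (k : Fin K) :
    (singlePacket p w i k).length = p.single := length_bits ..

@[simp] lemma length_coSinglePacket (w : Library n) (i : Fin 2) (k : Fin K) :
    (coSinglePacket p w i k).length = p.coSingle := length_bits ..

@[simp] lemma length_fullSegment (w : Library n) (i : Fin 2) :
    (fullSegment K p w i).length = p.full i := length_bits ..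

@[simp] lemma length_uncachedSegment (w : Library n) (i : Fin 2) :
    (uncachedSegment K p w i).length =
      n i.succ - (K * p.single + K * p.coSingle + p.full i) := length_bits ..

lemma length_filter_ne (k : Fin K) : ((List.finRange K).filter fun j => j ≠ k).length = K - 1 := by
  rw [← List.toFinset_card_of_nodup ((List.nodup_finRange K).filter _)]
  have : ((List.finRange K).filter fun j => j ≠ k).toFinset = Finset.univ.erase k := by
    ext; simp
  rw [this, Finset.card_erase_of_mem (Finset.mem_univ k)]
  simp

lemma length_cacheList (k : Fin K) (w : Library n) :
    (cacheList p k w).length =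
      p.common + ∑ i, (p.single + (K - 1) * p.coSingle + p.full i) := by
  have h := length_filter_ne k
  simp only [ne_eq, decide_not] at h
  simp [cacheList, List.length_flatMap, List.finRange_succ, Fin.sum_univ_two, h]
  ring

/-- Equal caches agree on all the packets that they hold. -/
lemma of_cacheList_eq {k : Fin K} {w w' : Library n} (h : cacheList p k w = cacheList p k w') :
    bits w 0 0 p.common = bits w' 0 0 p.common ∧
      ∀ i, singlePacket p w i k = singlePacket p w' i k ∧
        (∀ j, j ≠ k → coSinglePacket p w i j = coSinglePacket p w' i j) ∧
        fullSegment K p w i = fullSegment K p w' i := by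
  obtain ⟨h0, h1⟩ := List.append_inj h (by simp)
  refine ⟨h0, fun i => ?_⟩
  have h2 := eq_of_flatMap_eq (by simp [List.length_flatMap]) h1 i (List.mem_finRange i)
  obtain ⟨h3, h4⟩ := List.append_inj h2 (by simp [List.length_flatMap])
  obtain ⟨h5, h6⟩ := List.append_inj h3 (by simp)
  exact ⟨h5, fun j hj => eq_of_flatMap_eq (by simp) h6 j (by simpa using hj), h4⟩

lemma length_xor_fold (d : Demand K) (w : Library n) :
    (((List.finRange K).map fun k => coSinglePacket p w (d k) k).foldl xorBits
      (List.replicate p.coSingle false)).length = p.coSingle :=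
  length_foldl_xorBits (by simp) (by simp)

lemma length_codewordList (d : Demand K) (w : Library n) :
    (codewordList p d w).length = (n 0 - p.common) +
      (∑ i, if ∃ k, d k = i then
        n i.succ - (K * p.single + K * p.coSingle + p.full i) else 0) +
      (leaderPairs d).length * p.single + p.coSingle := by
  rw [codewordList, List.length_append, length_xor_fold]
  simp only [List.length_append, List.length_flatMap, length_bits, length_uncachedSegment,
    length_xorBits, length_singlePacket, min_self, List.map_const', List.sum_replicate,
    smul_eq_mul]
  congr 3
  by_cases h0 : ∃ k, d k = 0 <;> by_cases h1 : ∃ k, d k = 1 <;>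
    simp [List.finRange_succ, Fin.sum_univ_two, h0, h1]

lemma exists_isLeader (d : Demand K) (k : Fin K) : ∃ u, IsLeader d u ∧ d u = d k := by
  obtain ⟨u, hu, hmin⟩ := wellFounded_lt.has_min {u | d u = d k} ⟨k, rfl⟩
  exact ⟨u, fun l hl h => hmin l (h.trans hu) hl, hu⟩

/-- Equal codewords agree on all their parts. -/
lemma of_codewordList_eq {d : Demand K} {w w' : Library n}
    (h : codewordList p d w = codewordList p d w') :
    bits w 0 p.common (n 0 - p.common) = bits w' 0 p.common (n 0 - p.common) ∧
      (∀ k, uncachedSegment K p w (d k) = uncachedSegment K p w' (d k)) ∧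
      (∀ a b, a ≠ b → IsLeader d a ∨ IsLeader d b →
        xorBits (singlePacket p w (d a) b) (singlePacket p w (d b) a) =
          xorBits (singlePacket p w' (d a) b) (singlePacket p w' (d b) a)) ∧
      ((List.finRange K).map fun k => coSinglePacket p w (d k) k).foldl xorBits
          (List.replicate p.coSingle false) =
        ((List.finRange K).map fun k => coSinglePacket p w' (d k) k).foldl xorBits
          (List.replicate p.coSingle false) := by
  obtain ⟨h1, h2⟩ := List.append_inj' h (by rw [length_xor_fold, length_xor_fold])
  obtain ⟨h3, h4⟩ := List.append_inj' h1 (by simp [List.length_flatMap, length_xorBits])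
  obtain ⟨h5, h6⟩ := List.append_inj h3 (by simp)
  refine ⟨h5, fun k => ?_, ?_, h2⟩
  · exact eq_of_flatMap_eq (by simp) h6 (d k) (by simp)
  · have hpair : ∀ a b, a < b → IsLeader d a ∨ IsLeader d b →
        xorBits (singlePacket p w (d a) b) (singlePacket p w (d b) a) =
          xorBits (singlePacket p w' (d a) b) (singlePacket p w' (d b) a) := fun a b hab hl =>
      eq_of_flatMap_eq (by simp [length_xorBits]) h4 (a, b) (by
        rw [leaderPairs, List.mem_filter]
        exact ⟨List.mem_product.2 ⟨List.mem_finRange _, List.mem_finRange _⟩,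
          by simpa using ⟨hab, hl⟩⟩)
    intro a b hab hl
    rcases lt_or_gt_of_ne hab with hlt | hlt
    · exact hpair a b hlt hl
    · rw [xorBits_comm, xorBits_comm (singlePacket p w' _ _)]
      exact hpair b a hlt hl.symm

/-- A receiver can decode all single packets of the file that it requests. -/
lemma singlePacket_eq {d : Demand K} {k : Fin K} {w w' : Library n}
    (hk : ∀ i, singlePacket p w i k = singlePacket p w' i k)
    (hpair : ∀ a b, a ≠ b → IsLeader d a ∨ IsLeader d b →
        xorBits (singlePacket p w (d a) b) (singlePacket p w (d b) a) =
          xorBits (singlePacket p w' (d a) b) (singlePacket p w' (d b) a)) (l : Fin K) :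
    singlePacket p w (d k) l = singlePacket p w' (d k) l := by
  have step : ∀ a b, a ≠ b → IsLeader d a ∨ IsLeader d b →
      singlePacket p w (d b) a = singlePacket p w' (d b) a →
      singlePacket p w (d a) b = singlePacket p w' (d a) b := fun a b hab hl h => by
    have h1 := hpair a b hab hl
    rw [h] at h1
    exact xorBits_left_cancel h1 (by simp) (by simp)
  by_cases hlk : l = k
  · rw [hlk]
    exact hk _
  by_cases hl : IsLeader d k ∨ IsLeader d l
  · exact step k l (Ne.symm hlk) hl (hk _)
  -- No sum is sent for `k` and `l`, so the packet is reached through the leader `u` of the file of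
  -- `k`: the sum for `u, l` yields it once packet `u` of the file of `l` is known. If both request
  -- the same file, the sum for `k, u` gives that packet; otherwise the leader `v` of the other file
  -- gives it, via the sums for `k, v` and then `v, u`.
  obtain ⟨hk', hl'⟩ := not_or.1 hl
  obtain ⟨u, hu, hdu⟩ := exists_isLeader d k
  have huk : u ≠ k := fun h => hk' (h ▸ hu)
  have hul : u ≠ l := fun h => hl' (h ▸ hu)
  rw [← hdu]
  refine step u l hul (Or.inl hu) ?_
  by_cases hd : d l = d k
  · rw [hd]
    exact step k u huk.symm (Or.inr hu) (hk _)
  · obtain ⟨v, hv, hdv⟩ := exists_isLeader d l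
    have hvk : v ≠ k := fun h => hk' (h ▸ hv)
    have huv : u ≠ v := fun h => hd (by rw [← hdv, ← h, hdu])
    rw [← hdv]
    refine step v u huv.symm (Or.inl hv) ?_
    rw [hdu]
    exact step k v hvk.symm (Or.inr hv) (hk _)

lemma exists_packet {K m j : ℕ} (hj : j < K * m) :
    ∃ l : Fin K, (l : ℕ) * m ≤ j ∧ j < l * m + m := by
  have hm : 0 < m := Nat.pos_of_ne_zero fun h => by simp [h] at hj
  exact ⟨⟨j / m, Nat.div_lt_of_lt_mul (by rwa [mul_comm])⟩, Nat.div_mul_le_self j m,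
    Nat.lt_div_mul_add hm⟩

/-- The cache and the codeword determine the requested descriptions. -/
lemma eq_of_cacheList_eq_of_codewordList_eq {d : Demand K} {k : Fin K} {w w' : Library n}
    (hZ : cacheList p k w = cacheList p k w') (hY : codewordList p d w = codewordList p d w') :
    w 0 = w' 0 ∧ w (d k).succ = w' (d k).succ := by
  obtain ⟨hc0, hc⟩ := of_cacheList_eq p hZ
  obtain ⟨hy0, hunc, hpair, hfold⟩ := of_codewordList_eq p hY
  have hsingle := singlePacket_eq p (fun i => (hc i).1) hpair
  have hco : ∀ j, coSinglePacket p w (d k) j = coSinglePacket p w' (d k) j := fun j => by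
    by_cases hj : j = k
    · rw [hj]
      exact eq_of_foldl_xorBits_eq (m := p.coSingle)
        (f := fun k => coSinglePacket p w (d k) k) (g := fun k => coSinglePacket p w' (d k) k)
        (by simp) (by simp) (fun a ha => (hc (d a)).2.1 a ha) (List.nodup_finRange K)
        (List.mem_finRange k) (by simp) hfold
    · exact (hc (d k)).2.1 j hj
  refine ⟨eq_of_bit_eq fun j hj => ?_, eq_of_bit_eq fun j hj => ?_⟩
  · by_cases h : j < p.common
    · exact bit_eq_of_bits_eq hc0 (Nat.zero_le _) (by omega)
    · exact bit_eq_of_bits_eq hy0 (by omega) (by omega)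
  · by_cases h1 : j < K * p.single
    · obtain ⟨l, hl1, hl2⟩ := exists_packet h1
      exact bit_eq_of_bits_eq (hsingle l) hl1 hl2
    by_cases h2 : j < K * p.single + K * p.coSingle
    · obtain ⟨l, hl1, hl2⟩ := exists_packet (K := K) (m := p.coSingle) (j := j - K * p.single)
        (by omega)
      exact bit_eq_of_bits_eq (hco l) (by omega) (by omega)
    by_cases h3 : j < K * p.single + K * p.coSingle + p.full (d k)
    · exact bit_eq_of_bits_eq (hc (d k)).2.2 (by omega) (by omega)
    · exact bit_eq_of_bits_eq (hunc k) (by omega) (by omega)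

lemma splitScheme_not_fails {c : ℕ}
    (hc : p.common + ∑ i, (p.single + (K - 1) * p.coSingle + p.full i) ≤ c)
    (d : Demand K) (w : Library n) : ¬ (splitScheme K n c p).Fails d w := by
  rintro ⟨k, hk⟩
  apply hk
  have hex : ∃ w' : Library n, codewordList p d w' = (splitScheme K n c p).codeword d w ∧
      (fun j : Fin c => (cacheList p k w').getD j false) = (splitScheme K n c p).cache k w :=
    ⟨w, rfl, rfl⟩
  have hdec : (splitScheme K n c p).decode k d ((splitScheme K n c p).codeword d w)
      ((splitScheme K n c p).cache k w) = (hex.choose 0, hex.choose (d k).succ) := dif_pos hex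
  obtain ⟨hY, hZ⟩ := hex.choose_spec
  -- The cached list fits into the `c` bits and its length does not depend on the library, so
  -- padding with `false` loses no information.
  have hcache : cacheList p k hex.choose = cacheList p k w := by
    refine List.ext_getElem (by rw [length_cacheList, length_cacheList]) fun j hj hj' => ?_
    have hjc : j < c := lt_of_lt_of_le (by rwa [length_cacheList] at hj) hc
    have h1 : (cacheList p k hex.choose).getD j false = (cacheList p k w).getD j false :=
      congrFun hZ ⟨j, hjc⟩
    rwa [List.getD_eq_getElem _ _ hj, List.getD_eq_getElem _ _ hj'] at h1
  rw [hdec]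
  obtain ⟨h1, h2⟩ := eq_of_cacheList_eq_of_codewordList_eq p hcache hY
  rw [h1, h2]

lemma errorProb_eq_zero_of_not_fails {c : ℕ} {C : MRScheme K n c} (h : ∀ d w, ¬ C.Fails d w) :
    C.errorProb = 0 := by
  simp [MRScheme.errorProb, h]

end Split

end CodedCaching

namespace CodedCaching

/-! ### Normalized placements -/

namespace PrivateSplit

/-- The parts of the private descriptions have nonnegative rates and fit into the descriptions. -/
structure Valid (K : ℕ) (ρ : Fin 3 → ℝ) (P : PrivateSplit) : Prop where
  single_nonneg : 0 ≤ P.single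
  coSingle_nonneg : 0 ≤ P.coSingle
  full_nonneg : ∀ i, 0 ≤ P.full i
  le_rate : ∀ i : Fin 2, K * P.single + K * P.coSingle + P.full i ≤ ρ i.succ

/-- Cache memory that the placement needs. -/
def memory (K : ℕ) (P : PrivateSplit) : ℝ :=
  ∑ i, (P.single + (K - 1) * P.coSingle + P.full i)

/-- Average delivery rate of the private descriptions. -/
noncomputable def rate (K : ℕ) (ρ : Fin 3 → ℝ) (P : PrivateSplit) : ℝ :=
  (1 - 1 / 2 ^ K) * ∑ i : Fin 2, (ρ i.succ - (K * P.single + K * P.coSingle + P.full i)) +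
    (2 * K - 3 - 2 * (K - 2) / 2 ^ K) * P.single + P.coSingle

variable {K : ℕ} {ρ : Fin 3 → ℝ} {A B : PrivateSplit} {θ : ℝ}

lemma Valid.share (hA : A.Valid K ρ) (hB : B.Valid K ρ) (h0 : 0 ≤ θ) (h1 : θ ≤ 1) :
    (share θ A B).Valid K ρ := by
  have h1' : 0 ≤ 1 - θ := by linarith
  refine ⟨?_, ?_, fun i => ?_, fun i => ?_⟩
  · exact add_nonneg (mul_nonneg h1' hA.1) (mul_nonneg h0 hB.1)
  · exact add_nonneg (mul_nonneg h1' hA.2) (mul_nonneg h0 hB.2)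
  · exact add_nonneg (mul_nonneg h1' (hA.3 i)) (mul_nonneg h0 (hB.3 i))
  · have := add_le_add (mul_le_mul_of_nonneg_left (hA.4 i) h1')
      (mul_le_mul_of_nonneg_left (hB.4 i) h0)
    simp only [CodedCaching.share]
    linarith

lemma memory_share : (share θ A B).memory K = (1 - θ) * A.memory K + θ * B.memory K := by
  simp only [memory, share, Fin.sum_univ_two]
  ring

lemma rate_share : (share θ A B).rate K ρ = (1 - θ) * A.rate K ρ + θ * B.rate K ρ := by
  simp only [rate, share, Fin.sum_univ_two]
  ring

end PrivateSplit

/-! ### The four corner placements and memory sharing between them -/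

section Corners

variable {K : ℕ} {ρ : Fin 3 → ℝ}

lemma mul_gam (hK : 2 ≤ K) : K * gam K ρ = min (ρ 1) (ρ 2) := by
  have : (K : ℝ) ≠ 0 := by positivity
  rw [gam, mul_div_cancel₀ _ this]

lemma gam_nonneg (hρ : ∀ s, 0 ≤ ρ s) : 0 ≤ gam K ρ :=
  div_nonneg (le_min (hρ 1) (hρ 2)) (Nat.cast_nonneg K)

lemma two_mul_mul_gam_le (hK : 2 ≤ K) : 2 * (K * gam K ρ) ≤ ρ 1 + ρ 2 := by
  rw [mul_gam hK]
  linarith [min_le_left (ρ 1) (ρ 2), min_le_right (ρ 1) (ρ 2)]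

lemma four_mul_gam_le (hK : 2 ≤ K) (hρ : ∀ s, 0 ≤ ρ s) : 4 * gam K ρ ≤ ρ 1 + ρ 2 := by
  have h2 : (2 : ℝ) ≤ K := by exact_mod_cast hK
  nlinarith [two_mul_mul_gam_le (ρ := ρ) hK, gam_nonneg (K := K) hρ]

lemma min_le_succ (i : Fin 2) : min (ρ 1) (ρ 2) ≤ ρ i.succ := by
  fin_cases i <;> simp

lemma corner0_valid (hρ : ∀ s, 0 ≤ ρ s) : corner0.Valid K ρ :=
  ⟨le_rfl, le_rfl, fun _ => le_rfl, fun i => by simpa [corner0] using hρ _⟩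

lemma corner1_valid (hK : 2 ≤ K) (hρ : ∀ s, 0 ≤ ρ s) : (corner1 K ρ).Valid K ρ :=
  ⟨gam_nonneg hρ, le_rfl, fun _ => le_rfl, fun i => by
    simpa [corner1, mul_gam hK] using min_le_succ i⟩

lemma corner2_valid (hK : 2 ≤ K) (hρ : ∀ s, 0 ≤ ρ s) : (corner2 K ρ).Valid K ρ :=
  ⟨le_rfl, gam_nonneg hρ, fun i => sub_nonneg.2 (min_le_succ i), fun i => by
    simp [corner2, mul_gam hK]⟩

lemma corner3_valid (hρ : ∀ s, 0 ≤ ρ s) : (corner3 ρ).Valid K ρ :=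
  ⟨le_rfl, le_rfl, fun _ => hρ _, fun i => by simp [corner3]⟩

lemma memory_corner0 : corner0.memory K = 0 := by
  simp [PrivateSplit.memory, corner0]

lemma memory_corner1 : (corner1 K ρ).memory K = 2 * gam K ρ := by
  simp [PrivateSplit.memory, corner1]

lemma memory_corner2 (hK : 2 ≤ K) :
    (corner2 K ρ).memory K = ρ 1 + ρ 2 - 2 * gam K ρ := by
  simp only [PrivateSplit.memory, corner2, ← mul_gam hK, Fin.sum_univ_two,
    Fin.succ_zero_eq_one, Fin.succ_one_eq_two]
  ring

lemma memory_corner3 : (corner3 ρ).memory K = ρ 1 + ρ 2 := by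
  simp [PrivateSplit.memory, corner3]

lemma rate_corner0 : corner0.rate K ρ = (1 - 1 / 2 ^ K) * (ρ 1 + ρ 2) := by
  simp [PrivateSplit.rate, corner0]

lemma rate_corner1 :
    (corner1 K ρ).rate K ρ = gam K ρ + (1 - 1 / 2 ^ K) * (ρ 1 + ρ 2 - 4 * gam K ρ) := by
  simp only [PrivateSplit.rate, corner1, Fin.sum_univ_two, Fin.succ_zero_eq_one,
    Fin.succ_one_eq_two]
  ring

lemma rate_corner2 (hK : 2 ≤ K) : (corner2 K ρ).rate K ρ = gam K ρ := by
  simp only [PrivateSplit.rate, corner2, ← mul_gam hK, Fin.sum_univ_two, Fin.succ_zero_eq_one,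
    Fin.succ_one_eq_two]
  ring

lemma rate_corner3 : (corner3 ρ).rate K ρ = 0 := by
  simp [PrivateSplit.rate, corner3]

/-- Validity, memory and rate of the placement of the private descriptions. -/
lemma privateSplit_spec (hK : 2 ≤ K) (hρ : ∀ s, 0 ≤ ρ s) {m : ℝ} (h0 : 0 ≤ m)
    (hm : m ≤ ρ 1 + ρ 2) :
    (privateSplit K ρ m).Valid K ρ ∧ (privateSplit K ρ m).memory K = m ∧
      (m < 2 * gam K ρ → (privateSplit K ρ m).rate K ρ =
        (1 - 1 / 2 ^ K) * (ρ 1 + ρ 2) - (3 / 2 - 2 / 2 ^ K) * m) ∧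
      (2 * gam K ρ ≤ m → m ≤ ρ 1 + ρ 2 - 2 * gam K ρ → (privateSplit K ρ m).rate K ρ =
        gam K ρ + (1 - 1 / 2 ^ K) * (ρ 1 + ρ 2 - 2 * gam K ρ - m)) ∧
      (ρ 1 + ρ 2 - 2 * gam K ρ ≤ m →
        (privateSplit K ρ m).rate K ρ = (ρ 1 + ρ 2 - m) / 2) := by
  have hg := gam_nonneg (K := K) hρ
  have h4 := four_mul_gam_le hK hρ
  rcases lt_or_ge m (2 * gam K ρ) with h1 | h1
  · have hg' : 0 < 2 * gam K ρ := lt_of_le_of_lt h0 h1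
    have hg'' : gam K ρ ≠ 0 := by linarith
    rw [privateSplit, if_pos h1]
    refine ⟨(corner0_valid hρ).share (corner1_valid hK hρ) (by positivity)
      ((div_le_one hg').2 h1.le), ?_, fun _ => ?_, fun h => by linarith, fun h => by linarith⟩
    · rw [PrivateSplit.memory_share, memory_corner0, memory_corner1]
      field_simp
      ring
    · rw [PrivateSplit.rate_share, rate_corner0, rate_corner1]
      field_simp
      ring
  rcases lt_or_ge m (ρ 1 + ρ 2 - 2 * gam K ρ) with h2 | h2
  · have hd : 0 < ρ 1 + ρ 2 - 4 * gam K ρ := by linarith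
    have hθ := div_mul_cancel₀ (m - 2 * gam K ρ) hd.ne'
    rw [privateSplit, if_neg h1.not_gt, if_pos h2]
    refine ⟨(corner1_valid hK hρ).share (corner2_valid hK hρ)
      (div_nonneg (by linarith) hd.le) ((div_le_one hd).2 (by linarith)), ?_,
      fun h => by linarith, fun _ _ => ?_, fun h => by linarith⟩
    · rw [PrivateSplit.memory_share, memory_corner1, memory_corner2 hK]
      linear_combination hθ
    · rw [PrivateSplit.rate_share, rate_corner1, rate_corner2 hK]
      linear_combination -(1 - 1 / 2 ^ K : ℝ) * hθ
  · rw [privateSplit, if_neg h1.not_gt, if_neg h2.not_gt]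
    have hrate : (share ((m - (ρ 1 + ρ 2 - 2 * gam K ρ)) / (2 * gam K ρ)) (corner2 K ρ)
        (corner3 ρ)).rate K ρ = (ρ 1 + ρ 2 - m) / 2 := by
      rw [PrivateSplit.rate_share, rate_corner2 hK, rate_corner3]
      -- If `gam K ρ = 0`, the sharing weight is a division by zero, but then `m = ρ 1 + ρ 2` and
      -- the formula reads `0 = 0`.
      rcases hg.eq_or_lt with h | h
      · rw [← h] at h2 ⊢
        simp
        linarith
      · field_simp
        ring
    refine ⟨(corner2_valid hK hρ).share (corner3_valid hρ) (div_nonneg (by linarith) (by linarith))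
      (div_le_one_of_le₀ (by linarith) (by linarith)), ?_, fun h => by linarith, fun _ h => ?_,
      fun _ => hrate⟩
    · rw [PrivateSplit.memory_share, memory_corner2 hK, memory_corner3]
      rcases hg.eq_or_lt with h | h
      · rw [← h] at h2 ⊢
        simp
        linarith
      · field_simp
        ring
    · rw [hrate, le_antisymm h h2]
      ring

lemma commonMemory_nonneg (hρ : ∀ s, 0 ≤ ρ s) (M : ℝ) : 0 ≤ commonMemory K ρ M := by
  unfold commonMemory
  split_ifs <;> linarith [hρ 0]

lemma commonMemory_le (hρ : ∀ s, 0 ≤ ρ s) (M : ℝ) : commonMemory K ρ M ≤ ρ 0 := by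
  unfold commonMemory
  split_ifs <;> linarith [hρ 0]

lemma commonMemory_le_self (hρ : ∀ s, 0 ≤ ρ s) {M : ℝ} (hM : 0 ≤ M) :
    commonMemory K ρ M ≤ M := by
  have := gam_nonneg (K := K) hρ
  unfold commonMemory
  split_ifs <;> linarith [hρ 0]

lemma privateMemory_nonneg (hρ : ∀ s, 0 ≤ ρ s) {M : ℝ} (hM : 0 ≤ M) :
    0 ≤ privateMemory K ρ M :=
  le_min (sub_nonneg.2 (commonMemory_le_self hρ hM)) (add_nonneg (hρ 1) (hρ 2))

lemma privateMemory_le (M : ℝ) : privateMemory K ρ M ≤ ρ 1 + ρ 2 := min_le_right _ _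

end Corners

/-! ### The proposed scheme makes no errors -/

section Proposed

variable {K : ℕ} {ρ : Fin 3 → ℝ} {M : ℝ}

/-- Rounding every part down only shrinks the cached content, whose unrounded size per file bit is
at most `M`. -/
lemma proposedScheme_not_fails (hK : 2 ≤ K) (hρ : ∀ s, 0 ≤ ρ s) (hM : 0 ≤ M) (F : ℕ)
    (d : Demand K) (w : Library (descLength ρ F)) : ¬ (proposedScheme K ρ M F).Fails d w := by
  refine splitScheme_not_fails _ ?_ d w
  obtain ⟨hv, hmem, -⟩ := privateSplit_spec hK hρ (privateMemory_nonneg (K := K) hρ hM)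
    (privateMemory_le M)
  have hle : privateMemory K ρ M ≤ M - commonMemory K ρ M := min_le_left _ _
  set P := privateSplit K ρ (privateMemory K ρ M)
  have hF : (0 : ℝ) ≤ F := Nat.cast_nonneg F
  have hK1 : (0 : ℝ) ≤ (K : ℝ) - 1 := by
    have : (2 : ℝ) ≤ K := by exact_mod_cast hK
    linarith
  refine Nat.le_floor ?_
  have h0 := Nat.floor_le (mul_nonneg hF (commonMemory_nonneg (K := K) hρ M))
  have h1 := Nat.floor_le (mul_nonneg hF hv.single_nonneg)
  have h2 := mul_le_mul_of_nonneg_left (Nat.floor_le (mul_nonneg hF hv.coSingle_nonneg)) hK1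
  have h3 := fun i => Nat.floor_le (mul_nonneg hF (hv.full_nonneg i))
  have h4 := mul_le_mul_of_nonneg_left hle hF
  rw [← hmem, PrivateSplit.memory, Fin.sum_univ_two] at h4
  simp only [proposedSplit, Fin.sum_univ_two]
  push_cast [Nat.cast_sub (by omega : 1 ≤ K)]
  linarith [h3 0, h3 1]

/-! ### The rate of the proposed scheme -/

lemma IsLeader.eq {d : Demand K} {k l : Fin K} (hk : IsLeader d k) (hl : IsLeader d l)
    (h : d k = d l) : k = l := by
  rcases lt_trichotomy k l with hlt | heq | hlt
  · exact absurd h (hl k hlt)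
  · exact heq
  · exact absurd h.symm (hk l hlt)

lemma length_leaderPairs (d : Demand K) :
    (leaderPairs d).length = (Finset.univ.filter fun q : Fin K × Fin K =>
      q.1 < q.2 ∧ (IsLeader d q.1 ∨ IsLeader d q.2)).card := by
  rw [← List.toFinset_card_of_nodup]
  · congr 1
    ext ⟨a, b⟩
    simp [leaderPairs, List.pair_mem_product]
  · exact ((List.nodup_finRange K).product (List.nodup_finRange K)).filter _

/-- There is only one leader `u`, so a counted pair is fixed by its other member; `min` and `max`
list the pair in increasing order. -/
lemma length_leaderPairs_le_of_const {d : Demand K} (hd : ∀ k l, d k = d l) :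
    (leaderPairs d).length ≤ K - 1 := by
  rcases K.eq_zero_or_pos with rfl | hK
  · simp [leaderPairs]
  obtain ⟨u, hu, -⟩ := exists_isLeader d ⟨0, hK⟩
  rw [length_leaderPairs]
  calc _ ≤ ((Finset.univ.erase u).image fun b => (min u b, max u b)).card := by
        refine Finset.card_le_card fun q hq => ?_
        simp only [Finset.mem_filter, Finset.mem_univ, true_and] at hq
        obtain ⟨hlt, hl | hl⟩ := hq
        · refine Finset.mem_image.2 ⟨q.2, ?_, ?_⟩ <;> rw [hu.eq hl (hd _ _)]
          · simpa using hlt.ne'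
          · rw [min_eq_left hlt.le, max_eq_right hlt.le]
        · refine Finset.mem_image.2 ⟨q.1, ?_, ?_⟩ <;> rw [hu.eq hl (hd _ _)]
          · simpa using hlt.ne
          · rw [min_eq_right hlt.le, max_eq_left hlt.le]
    _ ≤ (Finset.univ.erase u).card := Finset.card_image_le
    _ = K - 1 := by rw [Finset.card_erase_of_mem (Finset.mem_univ _)]; simp

/-- With two leaders `u` and `v` there are `K - 1` pairs containing `u` and `K - 2` more containing
`v`. -/
lemma length_leaderPairs_le (hK : 2 ≤ K) (d : Demand K) : (leaderPairs d).length ≤ 2 * K - 3 := by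
  by_cases hd : ∀ k l, d k = d l
  · have := length_leaderPairs_le_of_const hd
    omega
  push Not at hd
  obtain ⟨a, b, hab⟩ := hd
  obtain ⟨u, hu, hua⟩ := exists_isLeader d a
  obtain ⟨v, hv, hvb⟩ := exists_isLeader d b
  have huv : u ≠ v := fun h => hab (by rw [← hua, h, hvb])
  have hlead : ∀ k, IsLeader d k → k = u ∨ k = v := fun k hk => by
    have : d k = d u ∨ d k = d v := by omega
    exact this.imp (hk.eq hu) (hk.eq hv)
  rw [length_leaderPairs]
  calc _ ≤ (((Finset.univ.erase u).image fun b => (min u b, max u b)) ∪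
        (((Finset.univ.erase u).erase v).image fun b => (min v b, max v b))).card := by
        refine Finset.card_le_card fun q hq => ?_
        simp only [Finset.mem_filter, Finset.mem_univ, true_and] at hq
        obtain ⟨hlt, hl⟩ := hq
        have hl' : q.1 = u ∨ q.2 = u ∨ (q.1 = v ∧ q.2 ≠ u) ∨ (q.2 = v ∧ q.1 ≠ u) := by
          rcases hl with hl | hl <;> rcases hlead _ hl with h | h <;> tauto
        rw [Finset.mem_union, Finset.mem_image, Finset.mem_image]
        rcases hl' with h | h | ⟨h, h'⟩ | ⟨h, h'⟩
        · exact Or.inl ⟨q.2, by simpa [← h] using hlt.ne',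
            by rw [← h, min_eq_left hlt.le, max_eq_right hlt.le]⟩
        · exact Or.inl ⟨q.1, by simpa [← h] using hlt.ne,
            by rw [← h, min_eq_right hlt.le, max_eq_left hlt.le]⟩
        · exact Or.inr ⟨q.2, by simpa [← h, h'] using hlt.ne',
            by rw [← h, min_eq_left hlt.le, max_eq_right hlt.le]⟩
        · exact Or.inr ⟨q.1, by simpa [← h, h'] using hlt.ne,
            by rw [← h, min_eq_right hlt.le, max_eq_left hlt.le]⟩
    _ ≤ (Finset.univ.erase u).card + ((Finset.univ.erase u).erase v).card :=
        (Finset.card_union_le _ _).trans (add_le_add Finset.card_image_le Finset.card_image_le)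
    _ = 2 * K - 3 := by
        rw [Finset.card_erase_of_mem (Finset.mem_erase.2 ⟨huv.symm, Finset.mem_univ _⟩),
          Finset.card_erase_of_mem (Finset.mem_univ _)]
        simp
        omega

/-- The two constant demands have at most `K - 1` pairs instead of `2 * K - 3`, which saves `K - 2`
for each. -/
lemma sum_length_leaderPairs_le (hK : 2 ≤ K) :
    ∑ d : Demand K, ((leaderPairs d).length : ℝ) ≤ 2 ^ K * (2 * K - 3) - 2 * (K - 2) := by
  have h2 : (2 : ℝ) ≤ K := by exact_mod_cast hK
  have hne : (fun _ : Fin K => (0 : Fin 2)) ≠ fun _ => 1 := fun h => by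
    simpa using congrFun h ⟨0, by omega⟩
  calc ∑ d : Demand K, ((leaderPairs d).length : ℝ)
      ≤ ∑ d : Demand K, ((2 * K - 3) - (if d = fun _ => 0 then (K - 2 : ℝ) else 0) -
          (if d = fun _ => 1 then (K - 2 : ℝ) else 0)) := by
        refine Finset.sum_le_sum fun d _ => ?_
        have hg : ((leaderPairs d).length : ℝ) ≤ 2 * K - 3 := by
          have : (leaderPairs d).length + 3 ≤ 2 * K := by
            have := length_leaderPairs_le hK d
            omega
          have : ((leaderPairs d).length : ℝ) + 3 ≤ 2 * K := by exact_mod_cast this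
          linarith
        have hc : (∀ k l, d k = d l) → ((leaderPairs d).length : ℝ) ≤ K - 1 := fun hd => by
          have : (leaderPairs d).length + 1 ≤ K := by
            have := length_leaderPairs_le_of_const hd
            omega
          have : ((leaderPairs d).length : ℝ) + 1 ≤ K := by exact_mod_cast this
          linarith
        by_cases h0 : d = fun _ => 0
        · have := hc (by simp [h0])
          rw [if_pos h0, if_neg (h0 ▸ hne)]
          linarith
        by_cases h1 : d = fun _ => 1
        · have := hc (by simp [h1])
          rw [if_pos h1, if_neg h0]
          linarith
        · rw [if_neg h0, if_neg h1]
          linarith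
    _ = _ := by
        simp only [Finset.sum_sub_distrib, Finset.sum_ite_eq', Finset.mem_univ, if_true,
          Finset.sum_const, Finset.card_univ, nsmul_eq_mul]
        simp [Demand]
        ring

lemma sum_requested_le (i : Fin 2) {u : ℝ} (hu : 0 ≤ u) :
    ∑ d : Demand K, (if ∃ k, d k = i then u else 0) ≤ (2 ^ K - 1) * u := by
  calc ∑ d : Demand K, (if ∃ k, d k = i then u else 0)
      ≤ ∑ d : Demand K, (u - if d = fun _ => i + 1 then u else 0) := by
        refine Finset.sum_le_sum fun d _ => ?_
        by_cases h : d = fun _ => i + 1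
        · simp [h]
        · rw [if_neg h]
          split_ifs <;> linarith
    _ = _ := by
        simp only [Finset.sum_sub_distrib, Finset.sum_ite_eq', Finset.mem_univ, if_true,
          Finset.sum_const, Finset.card_univ, nsmul_eq_mul]
        simp [Demand]
        ring

/-- Truncated subtraction is a maximum with `0`; this is continuous, so rounding does no harm even
when `x = y`. -/
lemma tendsto_natCast_tsub_div {a b : ℕ → ℕ} {x y : ℝ}
    (ha : Tendsto (fun F : ℕ => (a F : ℝ) / F) atTop (𝓝 x))
    (hb : Tendsto (fun F : ℕ => (b F : ℝ) / F) atTop (𝓝 y)) (hyx : y ≤ x) :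
    Tendsto (fun F : ℕ => ((a F - b F : ℕ) : ℝ) / F) atTop (𝓝 (x - y)) := by
  have h := (ha.sub hb).max (tendsto_const_nhds (x := (0 : ℝ)))
  rw [max_eq_left (by linarith)] at h
  refine h.congr fun F => ?_
  rw [← sub_div]
  rcases le_total (b F) (a F) with hle | hle
  · have : (b F : ℝ) ≤ a F := by exact_mod_cast hle
    rw [Nat.cast_sub hle, max_eq_left (div_nonneg (by linarith) (Nat.cast_nonneg F))]
  · have : (a F : ℝ) ≤ b F := by exact_mod_cast hle
    rw [Nat.sub_eq_zero_of_le hle, max_eq_right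
      (div_nonpos_of_nonpos_of_nonneg (by linarith) (Nat.cast_nonneg F))]
    simp

/-- Limit of the average rate of the proposed scheme. -/
noncomputable def limitRate (K : ℕ) (ρ : Fin 3 → ℝ) (M : ℝ) : ℝ :=
  let P := privateSplit K ρ (privateMemory K ρ M)
  (∑ d : Demand K, ((ρ 0 - commonMemory K ρ M) +
    (∑ i : Fin 2, if ∃ k, d k = i then
      ρ i.succ - (K * P.single + K * P.coSingle + P.full i) else 0) +
    (leaderPairs d).length * P.single + P.coSingle)) / 2 ^ K

lemma tendsto_avgRate_proposedScheme (hK : 2 ≤ K) (hρ : ∀ s, 0 ≤ ρ s) (hM : 0 ≤ M) :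
    Tendsto (fun F => avgRate (proposedScheme K ρ M F)) atTop (𝓝 (limitRate K ρ M)) := by
  obtain ⟨hv, -⟩ := privateSplit_spec hK hρ (privateMemory_nonneg (K := K) hρ hM)
    (privateMemory_le M)
  have hfloor : ∀ {x : ℝ}, 0 ≤ x →
      Tendsto (fun F : ℕ => (⌊(F : ℝ) * x⌋₊ : ℝ) / F) atTop (𝓝 x) :=
    tendsto_natFloor_natCast_mul_div
  have hlim : Tendsto (fun F : ℕ => (∑ d : Demand K,
      ((((descLength ρ F 0 - (proposedSplit K ρ M F).common : ℕ) : ℝ) / F) +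
        (∑ i : Fin 2, if ∃ k, d k = i then
          ((descLength ρ F i.succ - (K * (proposedSplit K ρ M F).single +
            K * (proposedSplit K ρ M F).coSingle + (proposedSplit K ρ M F).full i) : ℕ) : ℝ) / F
          else 0) +
        (leaderPairs d).length * (((proposedSplit K ρ M F).single : ℝ) / F) +
        ((proposedSplit K ρ M F).coSingle : ℝ) / F)) / 2 ^ K) atTop (𝓝 (limitRate K ρ M)) := by
    refine Tendsto.div_const (tendsto_finsetSum _ fun d _ => ?_) _
    refine Tendsto.add (Tendsto.add (Tendsto.add ?_ (tendsto_finsetSum _ fun i _ => ?_)) ?_) ?_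
    · exact tendsto_natCast_tsub_div (hfloor (hρ 0)) (hfloor (commonMemory_nonneg hρ M))
        (commonMemory_le hρ M)
    · by_cases h : ∃ k, d k = i
      · simp only [if_pos h]
        refine tendsto_natCast_tsub_div (hfloor (hρ i.succ)) ?_ (hv.le_rate i)
        have := (((hfloor hv.single_nonneg).const_mul (K : ℝ)).add
          ((hfloor hv.coSingle_nonneg).const_mul (K : ℝ))).add (hfloor (hv.full_nonneg i))
        refine this.congr fun F => ?_
        simp only [proposedSplit]
        push_cast
        ring
      · simp only [if_neg h]
        exact tendsto_const_nhds
    · exact (hfloor hv.single_nonneg).const_mul _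
    · exact hfloor hv.coSingle_nonneg
  refine hlim.congr fun F => ?_
  have hΩ : (Fintype.card (Library (descLength ρ F)) : ℝ) ≠ 0 := by
    exact_mod_cast Fintype.card_ne_zero
  -- The codeword length depends only on the demand, so the average over libraries is trivial.
  have hlen : ∀ d (w : Library (descLength ρ F)),
      (((proposedScheme K ρ M F).codeword d w).length : ℝ) = _ :=
    fun d w => congrArg Nat.cast (length_codewordList (proposedSplit K ρ M F) d w)
  have hD : (Fintype.card (Demand K) : ℝ) = 2 ^ K := by simp [Demand]
  simp only [avgRate, MRScheme.expectedLength, hlen, Finset.sum_const, Finset.card_univ,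
    nsmul_eq_mul, ← Finset.mul_sum, hD]
  rw [mul_comm (Fintype.card (Library (descLength ρ F)) : ℝ), mul_div_mul_right _ _ hΩ, div_right_comm]
  refine congrArg (· / (2 : ℝ) ^ K) ?_
  rw [Finset.sum_div]
  refine Finset.sum_congr rfl fun d _ => ?_
  push_cast
  rw [add_div, add_div, add_div, Finset.sum_div, mul_div_assoc]
  congr 3
  refine Finset.sum_congr rfl fun i _ => ?_
  split_ifs <;> simp

lemma limitRate_le (hK : 2 ≤ K) (hρ : ∀ s, 0 ≤ ρ s) (hM : 0 ≤ M) :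
    limitRate K ρ M ≤ ρ 0 - commonMemory K ρ M +
      (privateSplit K ρ (privateMemory K ρ M)).rate K ρ := by
  obtain ⟨hv, -⟩ := privateSplit_spec hK hρ (privateMemory_nonneg (K := K) hρ hM)
    (privateMemory_le M)
  set P := privateSplit K ρ (privateMemory K ρ M)
  have h2 : (0 : ℝ) < 2 ^ K := by positivity
  have hreq : ∑ d : Demand K, ∑ i : Fin 2, (if ∃ k, d k = i then
      ρ i.succ - (K * P.single + K * P.coSingle + P.full i) else 0) ≤
      (2 ^ K - 1) * ∑ i : Fin 2, (ρ i.succ - (K * P.single + K * P.coSingle + P.full i)) := by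
    rw [Finset.sum_comm, Finset.mul_sum]
    exact Finset.sum_le_sum fun i _ => sum_requested_le i (sub_nonneg.2 (hv.le_rate i))
  have hpairs := mul_le_mul_of_nonneg_right (sum_length_leaderPairs_le hK) hv.single_nonneg
  rw [limitRate, div_le_iff₀ h2]
  simp only [Finset.sum_add_distrib, ← Finset.sum_mul, PrivateSplit.rate]
  simp only [Finset.sum_const, Finset.card_univ, nsmul_eq_mul]
  have hD : (Fintype.card (Demand K) : ℝ) = 2 ^ K := by simp [Demand]
  rw [hD]
  have hexp : (ρ 0 - commonMemory K ρ M + ((1 - 1 / 2 ^ K) *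
      ∑ i : Fin 2, (ρ i.succ - (K * P.single + K * P.coSingle + P.full i)) +
      (2 * K - 3 - 2 * (K - 2) / 2 ^ K) * P.single + P.coSingle)) * 2 ^ K =
      2 ^ K * (ρ 0 - commonMemory K ρ M) + (2 ^ K - 1) *
        (∑ i : Fin 2, (ρ i.succ - (K * P.single + K * P.coSingle + P.full i))) +
        (2 ^ K * (2 * K - 3) - 2 * (K - 2)) * P.single + 2 ^ K * P.coSingle := by
    field_simp
    ring
  linarith

/-! ### Comparison of the proposed scheme with the converse -/

lemma errorProb_proposedScheme (hK : 2 ≤ K) (hρ : ∀ s, 0 ≤ ρ s) (hM : 0 ≤ M) (F : ℕ) :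
    (proposedScheme K ρ M F).errorProb = 0 :=
  errorProb_eq_zero_of_not_fails (proposedScheme_not_fails hK hρ hM F)

lemma achievable_limitRate (hK : 2 ≤ K) (hρ : ∀ s, 0 ≤ ρ s) (hM : 0 ≤ M) :
    Achievable K ρ (limitRate K ρ M) M := by
  refine ⟨hM, proposedScheme K ρ M, ?_, ?_⟩
  · simp only [errorProb_proposedScheme hK hρ hM]
    exact tendsto_const_nhds
  · exact ((continuous_coe_real_ereal.tendsto _).comp
      (tendsto_avgRate_proposedScheme hK hρ hM)).limsup_eq.le

/-- The proposed scheme is optimal when the memory is large. -/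
lemma limitRate_le_optimalRate (hK : 2 ≤ K) (hρ : ∀ s, 0 ≤ ρ s) (hM : 0 ≤ M)
    (hM' : ρ 0 + ρ 1 + ρ 2 - 2 * gam K ρ ≤ M) : limitRate K ρ M ≤ optimalRate K ρ M := by
  refine le_optimalRate (achievable_limitRate hK hρ hM) fun r hr => ?_
  have hB := lengthBound_one_receiver.le_of_mem_region hK hρ hr
  have h0 := nonneg_of_mem_region hr
  have hle := limitRate_le hK hρ hM
  obtain ⟨-, -, -, -, h3⟩ := privateSplit_spec hK hρ (privateMemory_nonneg (K := K) hρ hM)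
    (privateMemory_le M)
  have hg := gam_nonneg (K := K) hρ
  have h4 := four_mul_gam_le hK hρ
  simp only [Fin.sum_univ_three, Matrix.cons_val] at hB
  have hc : commonMemory K ρ M = ρ 0 := by
    rw [commonMemory, if_neg (by linarith [hρ 0]), if_neg (by linarith)]
  have hm : privateMemory K ρ M = min (M - ρ 0) (ρ 1 + ρ 2) := by rw [privateMemory, hc]
  have := h3 (by rw [hm]; exact le_min (by linarith) (by linarith))
  rw [this, hc, hm] at hle
  rcases min_cases (M - ρ 0) (ρ 1 + ρ 2) with ⟨h, -⟩ | ⟨h, -⟩ <;> rw [h] at hle <;> linarith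

/-- With `q = 2^(-K)` this gives `(K - 2) * q ≤ 1 - 4 * q`, the inequality that closes the hardest
case of the gap bound. -/
lemma two_pow_ge_add_two (hK : 2 ≤ K) : (K : ℝ) + 2 ≤ 2 ^ K := by
  have : K + 2 ≤ 2 ^ K := by
    induction K, hK using Nat.le_induction with
    | base => norm_num
    | succ k hk ih => rw [pow_succ]; omega
  exact_mod_cast this

/-- The proposed scheme is nearly optimal for every memory. -/
lemma limitRate_sub_optimalRate_le (hK : 2 ≤ K) (hρ : ∀ s, 0 ≤ ρ s) (hM : 0 ≤ M) :
    limitRate K ρ M - optimalRate K ρ M ≤ (1 / 4 - 1 / 2 ^ K) * (ρ 1 + ρ 2) := by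
  have hpow := two_pow_ge_add_two hK
  have hK2 : (2 : ℝ) ≤ K := by exact_mod_cast hK
  set q : ℝ := 1 / 2 ^ K with hq
  have hq0 : 0 < q := by positivity
  have hqK : (K + 2) * q ≤ 1 := by
    rw [hq, mul_one_div, div_le_one (by positivity)]
    exact hpow
  have hq4 : q ≤ 1 / 4 := by nlinarith
  have hS : 0 ≤ ρ 1 + ρ 2 := add_nonneg (hρ 1) (hρ 2)
  have hgap : 0 ≤ (1 / 4 - q) * (ρ 1 + ρ 2) := mul_nonneg (by linarith) hS
  by_cases hlarge : ρ 0 + ρ 1 + ρ 2 - 2 * gam K ρ ≤ M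
  · linarith [limitRate_le_optimalRate hK hρ hM hlarge]
  push Not at hlarge
  rw [sub_le_comm]
  refine le_optimalRate (achievable_limitRate hK hρ hM) fun r hr => ?_
  have hA := lengthBound_two_receivers.le_of_mem_region hK hρ hr
  have hC := lengthBound_mixed_one.le_of_mem_region hK hρ hr
  have hC' := lengthBound_mixed_two.le_of_mem_region hK hρ hr
  simp only [Fin.sum_univ_three, Matrix.cons_val] at hA hC hC'
  have hle := limitRate_le hK hρ hM
  obtain ⟨-, -, h1, h2, -⟩ := privateSplit_spec hK hρ (privateMemory_nonneg (K := K) hρ hM)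
    (privateMemory_le M)
  rw [← hq] at h1 h2
  have hg := gam_nonneg (K := K) hρ
  have h4 := four_mul_gam_le hK hρ
  -- In the first two ranges the two-receiver bound suffices: the excess is `(1/4 - q) * (ρ 1 + ρ
  -- 2)` minus `(1/2 - 2 * q) * M`, respectively minus `(1 - 4 * q) * gam K ρ`.
  rcases lt_or_ge M (2 * gam K ρ) with hM1 | hM1
  · have hc : commonMemory K ρ M = 0 := by rw [commonMemory, if_pos hM1]
    have hm : privateMemory K ρ M = M := by
      rw [privateMemory, hc, sub_zero, min_eq_left (by linarith)]
    rw [hm] at h1 hle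
    rw [h1 hM1, hc, ← mul_one_div 2, ← hq] at hle
    have := mul_nonneg (by linarith : (0 : ℝ) ≤ 1 / 2 - 2 * q) hM
    linarith
  rcases lt_or_ge M (2 * gam K ρ + ρ 0) with hM2 | hM2
  · have hc : commonMemory K ρ M = M - 2 * gam K ρ := by
      rw [commonMemory, if_neg hM1.not_gt, if_pos hM2]
    have hm : privateMemory K ρ M = 2 * gam K ρ := by
      rw [privateMemory, hc, sub_sub_cancel, min_eq_left (by linarith)]
    rw [hm] at h2 hle
    rw [h2 le_rfl (by linarith), hc] at hle
    have := mul_nonneg (by linarith : (0 : ℝ) ≤ 1 / 4 - q) hg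
    linarith
  · have hc : commonMemory K ρ M = ρ 0 := by
      rw [commonMemory, if_neg hM1.not_gt, if_neg hM2.not_gt]
    have hm : privateMemory K ρ M = M - ρ 0 := by
      rw [privateMemory, hc, min_eq_left (by linarith)]
    rw [hm] at h2 hle
    rw [h2 (by linarith) (by linarith), hc] at hle
    have hC2 : 3 * ρ 0 + 3 * (ρ 1 + ρ 2) - K * gam K ρ - 3 * M ≤ 4 * r := by
      rw [mul_gam hK]
      rcases min_cases (ρ 1) (ρ 2) with ⟨h, -⟩ | ⟨h, -⟩ <;> rw [h] <;> linarith
    -- Here `x` is the distance to the optimal range, and the rate is at most `gam K ρ + (1 - q) *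
    -- x`. With `S = ρ 1 + ρ 2`, the two-receiver bound leaves excess `S / 4 - gam K ρ - q * x`, the
    -- mixed bound `(1/4 - q) * x + (K - 2) * gam K ρ / 4`. The first is small enough if `q * S ≤ q
    -- * x + gam K ρ`; otherwise `gam K ρ ≤ q * (S - x)` makes the second small enough.
    obtain ⟨x, hx⟩ : ∃ x, x = ρ 0 + ρ 1 + ρ 2 - 2 * gam K ρ - M := ⟨_, rfl⟩
    obtain rfl : M = ρ 0 + ρ 1 + ρ 2 - 2 * gam K ρ - x := by linarith
    rcases le_total (q * (ρ 1 + ρ 2)) (q * x + gam K ρ) with h | h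
    · linarith
    · have h5 : (K - 2) * gam K ρ ≤ (1 - 4 * q) * (ρ 1 + ρ 2 - x) := by
        have hSx : gam K ρ ≤ q * (ρ 1 + ρ 2 - x) := by linarith
        have hSx0 : 0 ≤ ρ 1 + ρ 2 - x := by linarith
        calc (K - 2) * gam K ρ ≤ (K - 2) * (q * (ρ 1 + ρ 2 - x)) :=
              mul_le_mul_of_nonneg_left hSx (by linarith)
          _ = ((K - 2) * q) * (ρ 1 + ρ 2 - x) := by ring
          _ ≤ _ := mul_le_mul_of_nonneg_right (by linarith) hSx0
      linarith

end Proposed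

end CodedCaching

theorem mainTheorem7 (K : ℕ) (hK : 2 ≤ K) (ρ : Fin 3 → ℝ) (hρ : ∀ s, 0 ≤ ρ s)
    (M : ℝ) (hM : 0 ≤ M) :
    Tendsto (fun F => (CodedCaching.proposedScheme K ρ M F).errorProb) atTop (𝓝 0) ∧
    ∃ R : ℝ,
      Tendsto (fun F => CodedCaching.avgRate (CodedCaching.proposedScheme K ρ M F)) atTop (𝓝 R) ∧
      (M ∈ Set.Icc (ρ 0 + ρ 1 + ρ 2 - 2 / (K : ℝ) * min (ρ 1) (ρ 2)) (ρ 0 + ρ 1 + ρ 2) →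
        R = CodedCaching.optimalRate K ρ M) ∧
      (M ∉ Set.Icc (ρ 0 + ρ 1 + ρ 2 - 2 / (K : ℝ) * min (ρ 1) (ρ 2)) (ρ 0 + ρ 1 + ρ 2) →
        CodedCaching.optimalRate K ρ M ≤ R ∧
        R - CodedCaching.optimalRate K ρ M ≤ (1 / 4 - 1 / 2 ^ K) * (ρ 1 + ρ 2)) ∧
      (K = 2 → R = CodedCaching.optimalRate K ρ M) := by
  have hopt := CodedCaching.optimalRate_le (CodedCaching.achievable_limitRate hK hρ hM)
  have hgap := CodedCaching.limitRate_sub_optimalRate_le hK hρ hM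
  refine ⟨?_, CodedCaching.limitRate K ρ M, CodedCaching.tendsto_avgRate_proposedScheme hK hρ hM,
    fun h => ?_, fun _ => ⟨hopt, hgap⟩, fun h => ?_⟩
  · simp only [CodedCaching.errorProb_proposedScheme hK hρ hM]
    exact tendsto_const_nhds
  · refine le_antisymm (CodedCaching.limitRate_le_optimalRate hK hρ hM ?_) hopt
    have : 2 / (K : ℝ) * min (ρ 1) (ρ 2) = 2 * CodedCaching.gam K ρ := by
      rw [CodedCaching.gam]
      ring
    linarith [h.1]
  · subst h
    norm_num at hgap
    exact le_antisymm hgap hopt
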